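/- Let $\boldsymbol n=(n_1,n_2)$ and $\boldsymbol m=(m_1,m_2)$ be pairs of nonnegative integers with $n_1+n_2=m_1+m_2$. For $\boldsymbol\mu,\boldsymbol w\in\mathbb C^2$, $\boldsymbol k=(k_1,k_2)\in\mathbb Z_{\ge0}^2$ and $\ell\ge 0$ define the master function $$\Phi(t_1,\dots,t_\ell;\boldsymbol\mu;\boldsymbol w;\boldsymbol k)=e^{\mu_1(k_1w_1+k_2w_2)+(\mu_2-\mu_1)\sum_j t_j}\,(w_1-w_2)^{k_1k_2}\prod_{j=1}^{\ell}(t_j-w_1)^{-k_1}(t_j-w_2)^{-k_2}\prod_{1\le j<j'\le \ell}(t_j-t_{j'})^2 .$$ A point $t\in\mathbb C^\ell$ is admissible if $\Phi$ is well defined and nonzero at $t$; a critical point is a critical point with respect to $t$. A polynomial $y$ represents the orbit of $t$ under permutations of coordinates if $y=c\prod_j(x-t_j)$ with $c\neq0$. For $\boldsymbol\lambda,\boldsymbol z\in\mathbb C^2$, each with distinct coordinates, a space of the $(\boldsymbol\lambda,\boldsymbol z,\boldsymbol n,\boldsymbol m)$-type is a space $V=\langle p_1(x)e^{\lambda_1x},p_2(x)e^{\lambda_2x}\rangle$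 with $p_i\in\mathbb C[x]$, $\deg p_i=n_i$, such that the set of orders of vanishing at a point $x$ of the nonzero functions in $V$ is $\{0,m_a+1\}$ if $x=z_a$, and $\{0,1\}$ if $x\notin\{z_1,z_2\}$. Its special bispectral dual is the space $U$ spanned by the functions $$u\mapsto\int_{\gamma_a}e^{ux}\,\frac{f(x)}{{\rm Wr}_V(x)}\,\frac{dx}{(x-z_1)(x-z_2)},\qquad f\in V,\ a=1,2,$$ where ${\rm Wr}_V$ is the Wronskian of a basis of $V$ and $\gamma_a$ is a small circle around $z_a$. Theorem. There is a nonzero polynomial $P$ in $\lambda_1,\lambda_2,z_1,z_2$, depending only on $\boldsymbol n,\boldsymbol m$, such that the following holds whenever $P(\boldsymbol\lambda,\boldsymbol z)\ne0$ (that is, for generic $\boldsymbol\lambda,\boldsymbol z$). Let $(t_1,\dots,t_{n_2})$ be an admissible critical point of $\Phi(\,\cdot\,;\boldsymbol\lambda;\boldsymbol z;\boldsymbol m)$ and let $y=\prod_{j}(x-t_j)$. Then there is a space $V$ of the $(\boldsymbol\lambda,\boldsymbol z,\boldsymbol n,\boldsymbol m)$-type associated with it, i.e. annihilated by $$\Bigl(\partial_x-\ln'\frac{e^{\lambda_1x}(x-z_1)^{m_1}(x-z_2)^{m_2}}{y}\Bigr)\bigl(\partial_x-\ln'(y\,e^{\lambda_2x})\bigr).$$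 For every such $V$, the special bispectral dual $U$ has the form $\langle q_1(u)e^{z_1u},q_2(u)e^{z_2u}\rangle$ with polynomials $q_1,q_2$, and whenever $V=\langle p_1e^{\lambda_1x},p_2e^{\lambda_2x}\rangle$ and $U=\langle q_1e^{z_1u},q_2e^{z_2u}\rangle$ with polynomials $p_i,q_a$: (1) $p_1$ represents the orbit of an admissible critical point of $\Phi(t_1,\dots,t_{n_1};(\lambda_2,\lambda_1);\boldsymbol z;\boldsymbol m)$, and $p_1$ has no root in $\{z_1,z_2\}$; (2) $q_2$ represents the orbit of an admissible critical point of $\Phi(t_1,\dots,t_{m_2};\boldsymbol z;\boldsymbol\lambda;\boldsymbol n)$, and $q_2$ has no root in $\{\lambda_1,\lambda_2\}$. -/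

import Mathlib

open Polynomial

noncomputable section

namespace GaudinDuality

/-- The master function `Φ(t₁,…,t_k; μ; z; m)` (the case of two exponents and two points):
`exp(μ₁(m₁z₁ + m₂z₂) + (μ₂ - μ₁) ∑ t_j) (z₁ - z₂)^(m₁m₂)
  ∏ (t_j - z₁)^(-m₁) (t_j - z₂)^(-m₂) ∏_{j < j'} (t_j - t_{j'})²`. -/
def masterFunction {k : ℕ} (mu z : Fin 2 → ℂ) (m : Fin 2 → ℕ) (t : Fin k → ℂ) : ℂ :=
  Complex.exp (mu 0 * (m 0 * z 0 + m 1 * z 1) + (mu 1 - mu 0) * ∑ j, t j)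
    * (z 0 - z 1) ^ (m 0 * m 1)
    * (∏ j, (t j - z 0) ^ (-(m 0 : ℤ)) * (t j - z 1) ^ (-(m 1 : ℤ)))
    * ∏ j, ∏ j' ∈ Finset.Ioi j, (t j - t j') ^ 2

/-- `t` is admissible: the value of the master function at `t` is well defined
(no zero is raised to a negative power) and is not zero. -/
def IsAdmissible {k : ℕ} (mu z : Fin 2 → ℂ) (m : Fin 2 → ℕ) (t : Fin k → ℂ) : Prop :=
  (∀ j a, m a ≠ 0 → t j ≠ z a) ∧ masterFunction mu z m t ≠ 0

/-- `t` is a critical point of the master function, as a function of `t`. -/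
def IsCriticalPoint {k : ℕ} (mu z : Fin 2 → ℂ) (m : Fin 2 → ℕ) (t : Fin k → ℂ) : Prop :=
  HasFDerivAt (𝕜 := ℂ) (masterFunction mu z m) (0 : (Fin k → ℂ) →L[ℂ] ℂ) t

/-- The polynomial `y` (taken up to a nonzero factor) represents the orbit of `t` under
permutations of coordinates. -/
def Represents {k : ℕ} (y : ℂ[X]) (t : Fin k → ℂ) : Prop :=
  ∃ c : ℂ, c ≠ 0 ∧ y = C c * ∏ j, (X - C (t j))

/-- `y` represents the orbit of an admissible critical point of `Φ(t₁,…,t_k; μ; z; m)`, and is an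
admissible polynomial: it has no root in `{z₁, z₂}`. (The last clause adds something to the
admissibility of the point only if `m₁ = 0` or `m₂ = 0`; multiple roots are already excluded.) -/
def RepresentsAdmissibleCriticalPoint (k : ℕ) (mu z : Fin 2 → ℂ) (m : Fin 2 → ℕ)
    (y : ℂ[X]) : Prop :=
  (∃ t : Fin k → ℂ, Represents y t ∧ IsAdmissible mu z m t ∧ IsCriticalPoint mu z m t) ∧
    ∀ a, y.eval (z a) ≠ 0

/-- The space `⟨p₁(x) e^(μ₁x), p₂(x) e^(μ₂x)⟩`. -/
def quasiSpan (mu : Fin 2 → ℂ) (p : Fin 2 → ℂ[X]) : Submodule ℂ (ℂ → ℂ) :=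
  Submodule.span ℂ (Set.range fun (i : Fin 2) (x : ℂ) => (p i).eval x * Complex.exp (mu i * x))

/-- The set of exponents of `V` at `x`: all orders at `x` of the functions in `V`. -/
def exponents (V : Submodule ℂ (ℂ → ℂ)) (x : ℂ) : Set ℤ :=
  {e | ∃ f ∈ V, meromorphicOrderAt f x = (e : WithTop ℤ)}

/-- `(V, z)` is a space of the `(μ, z, n, m)`-type (a special space), with `N = M = 2`. -/
structure IsSpecialSpace (mu z : Fin 2 → ℂ) (n m : Fin 2 → ℕ)
    (V : Submodule ℂ (ℂ → ℂ)) : Prop where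
  mu_injective : Function.Injective mu
  z_injective : Function.Injective z
  exists_basis : ∃ p : Fin 2 → ℂ[X], (∀ i, (p i).degree = n i) ∧ V = quasiSpan mu p
  exponents_regular : ∀ x, (∀ a, x ≠ z a) → exponents V x = {0, 1}
  exponents_at : ∀ a, exponents V (z a) = {0, 1 + (m a : ℤ)}

/-- The first order operator `∂_x - ln' g`. -/
def firstOrderOp (g f : ℂ → ℂ) : ℂ → ℂ := fun x => deriv f x - logDeriv g x * f x

/-- The monic operator
`(∂_x - ln'(e^(μ₁x) (x-z₁)^m₁ (x-z₂)^m₂ / y)) (∂_x - ln'(y e^(μ₂x)))`,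
where `y = (x - t₁)⋯(x - t_k)`. -/
def criticalPointOp {k : ℕ} (mu z : Fin 2 → ℂ) (m : Fin 2 → ℕ) (t : Fin k → ℂ)
    (f : ℂ → ℂ) : ℂ → ℂ :=
  firstOrderOp
    (fun x => Complex.exp (mu 0 * x) * (∏ a, (x - z a) ^ m a) / ∏ j, (x - t j))
    (firstOrderOp (fun x => (∏ j, (x - t j)) * Complex.exp (mu 1 * x)) f)

/-- `V` is the space of the `(μ, z, n, m)`-type associated with the orbit of `t`: its monic
fundamental operator (the monic operator of order `2 = dim V` that annihilates it) is
`criticalPointOp`. The equation is one between meromorphic functions, so it is required off the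
possible poles of the coefficients. -/
structure IsAssociatedSpace (mu z : Fin 2 → ℂ) (n m : Fin 2 → ℕ) (t : Fin (n 1) → ℂ)
    (V : Submodule ℂ (ℂ → ℂ)) : Prop where
  special : IsSpecialSpace mu z n m V
  annihilates : ∀ f ∈ V, ∀ x, (∀ a, x ≠ z a) → (∀ j, x ≠ t j) → criticalPointOp mu z m t f x = 0

/-- The Wronskian of two functions. -/
def wronskian (f g : ℂ → ℂ) : ℂ → ℂ := fun x => f x * deriv g x - deriv f x * g x

/-- The conjugate space `V⋆` of a two-dimensional space `V`: the span of the functions `f / Wr_V`,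
`f ∈ V`, where `Wr_V` is the Wronskian of a basis `g, h` of `V` (unique up to a constant). -/
def conjugateSpace (V : Submodule ℂ (ℂ → ℂ)) : Submodule ℂ (ℂ → ℂ) :=
  Submodule.span ℂ {F | ∃ f ∈ V, ∃ g ∈ V, ∃ h ∈ V, LinearIndependent ℂ ![g, h] ∧
    F = fun x => f x / wronskian g h x}

/-- The special bispectral dual `U` of `(V, z)`: the span of the functions
`u ↦ ∮_{γ_a} e^(ux) f(x) ∏_b (x - z_b)⁻¹ dx`, where `f ∈ V⋆` and `γ_a` is a small circle around
`z_a`, that is, one whose closed disc contains no other `z_b`. -/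
def specialBispectralDual (z : Fin 2 → ℂ) (V : Submodule ℂ (ℂ → ℂ)) : Submodule ℂ (ℂ → ℂ) :=
  Submodule.span ℂ {F | ∃ f ∈ conjugateSpace V, ∃ (a : Fin 2) (r : ℝ),
    0 < r ∧ (∀ b, b ≠ a → r < dist (z b) (z a)) ∧
    F = fun u => ∮ x in C(z a, r), Complex.exp (u * x) * f x * ∏ b, (x - z b)⁻¹}

end GaudinDuality

end

/-!
A pair of quasi-polynomials `p₁ e^(λ₁x), p₂ e^(λ₂x)` has Wronskian `∏ (x - z_a)^(m_a)`, up to an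
exponential factor, iff `(λ₁ - λ₂) p₁ p₂ + p₁' p₂ - p₁ p₂' = c ∏ (x - z_a)^(m_a)`. If `p₂` does
not vanish at `z`, dividing this twisted Wronskian equation by `p₂` and comparing residues shows
that a polynomial `p₁` solving it exists iff the roots of `p₂` satisfy the Bethe equations, that is,
form an admissible critical point of the master function. The equation is antisymmetric, so `p₁`
is a critical point for the exchanged exponents as soon as it does not vanish at `z` either.

The functions of the bispectral dual are the residues `q_a e^(z_a u)` of
`e^(ux) p_i e^(-λ_j x) / ∏ (x - z_b)^(m_b + 1)`, `{i, j} = {1, 2}`. Up to proportionality they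
depend only on `a`, because every function of the space that vanishes at `z_a` vanishes there to
order `m_a + 1`. The Taylor coefficients at `u = λ_j` of their sum over `a` are sums of all residues
of rational functions; they vanish up to order `n_j` by degree count. Hence the Wronskian of the
dual space is divisible by `∏ (u - λ_j)^(n_j)`, and it equals this product up to a constant by
degrees.

If a solution `p` of the twisted Wronskian equation vanishes at `z₁`, it vanishes there to order
`m₁ + 1`, and an affine change of variable turns the equation into one that is solvable only for
finitely many values of `(λ₁ - λ₂)(z₁ - z₂)`; this is what genericity excludes.
-/

noncomputable section

namespace GaudinDuality

section TwistedWronskian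

section CommRing

variable {R : Type*} [CommRing R]

/-- The twisted Wronskian `p' y - p y' + κ p y` of two polynomials. If `κ = λ - μ`, then
`e^((λ + μ) x)` times it is the Wronskian `(p e^(λ x))' (y e^(μ x)) - (p e^(λ x)) (y e^(μ x))'` of
two quasi-polynomials; note that this is minus `wronskian`. -/
def twistedWronskian (κ : R) (p y : R[X]) : R[X] :=
  derivative p * y - p * derivative y + C κ * p * y

lemma twistedWronskian_eq_sub_wronskian (κ : R) (p y : R[X]) :
    twistedWronskian κ p y = C κ * (p * y) - Polynomial.wronskian p y := by
  simp only [twistedWronskian, Polynomial.wronskian]; ring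

lemma twistedWronskian_swap (κ : R) (p y : R[X]) :
    twistedWronskian (-κ) y p = -twistedWronskian κ p y := by
  simp only [twistedWronskian, C_neg]; ring

lemma twistedWronskian_C_mul_left (κ a : R) (p y : R[X]) :
    twistedWronskian κ (C a * p) y = C a * twistedWronskian κ p y := by
  simp only [twistedWronskian, derivative_C_mul]; ring

lemma twistedWronskian_C_mul_right (κ a : R) (p y : R[X]) :
    twistedWronskian κ p (C a * y) = C a * twistedWronskian κ p y := by
  simp only [twistedWronskian, derivative_C_mul]; ring

lemma twistedWronskian_add_left (κ : R) (p q y : R[X]) :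
    twistedWronskian κ (p + q) y = twistedWronskian κ p y + twistedWronskian κ q y := by
  simp only [twistedWronskian, derivative_add]; ring

lemma twistedWronskian_mul_self_left (κ : R) (r y : R[X]) :
    twistedWronskian κ (y * r) y = y ^ 2 * (derivative r + C κ * r) := by
  simp only [twistedWronskian, derivative_mul]; ring

lemma twistedWronskian_map {S : Type*} [CommRing S] (f : R →+* S) (κ : R) (p y : R[X]) :
    (twistedWronskian κ p y).map f = twistedWronskian (f κ) (p.map f) (y.map f) := by
  simp [twistedWronskian, derivative_map]

lemma twistedWronskian_comp_affine (κ a b : R) (p y : R[X]) :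
    twistedWronskian (κ * a) (p.comp (C a * X + C b)) (y.comp (C a * X + C b))
      = C a * (twistedWronskian κ p y).comp (C a * X + C b) := by
  simp only [twistedWronskian, sub_comp, add_comp, mul_comp, C_comp, derivative_comp,
    derivative_add, derivative_C_mul, derivative_X, derivative_C, C_mul]
  ring

lemma twistedWronskian_X_sub_C_pow_mul (κ a : R) (k : ℕ) (q y : R[X]) :
    twistedWronskian κ ((X - C a) ^ (k + 1) * q) y
      = (X - C a) ^ k * (C ((k + 1 : ℕ) : R) * q * y + (X - C a) * twistedWronskian κ q y) := by
  simp only [twistedWronskian, derivative_mul, derivative_X_sub_C_pow, Nat.add_sub_cancel]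
  ring

lemma twistedWronskian_twistedWronskian_derivative (κ : R) (p y : R[X]) :
    twistedWronskian κ (twistedWronskian κ p y) (derivative y)
      = y * twistedWronskian κ (derivative p + C κ * p) (derivative y) := by
  simp only [twistedWronskian, derivative_add, derivative_sub, derivative_mul, derivative_C]
  ring

lemma separable_of_twistedWronskian_eq {κ : R} {p y T : R[X]}
    (h : twistedWronskian κ p y = T) (hT : IsCoprime y T) : y.Separable := by
  have hpy : IsCoprime y (-p * derivative y) := by
    rw [← h, show twistedWronskian κ p y
        = -p * derivative y + y * (derivative p + C κ * p) by rw [twistedWronskian]; ring] at hT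
    exact IsCoprime.add_mul_left_right_iff.1 hT
  exact hpy.of_mul_right_right

lemma pow_succ_dvd_of_pow_dvd_twistedWronskian [IsDomain R] [CharZero R] {κ a : R} {k : ℕ}
    {p y : R[X]} (h : (X - C a) ^ k ∣ twistedWronskian κ p y) (hp : p.eval a = 0)
    (hy : y.eval a ≠ 0) : (X - C a) ^ (k + 1) ∣ p := by
  induction k with
  | zero => simpa using dvd_iff_isRoot.2 hp
  | succ k ih =>
    obtain ⟨q, rfl⟩ := ih ((pow_dvd_pow _ k.le_succ).trans h)
    rw [twistedWronskian_X_sub_C_pow_mul, pow_succ,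
      mul_dvd_mul_iff_left (pow_ne_zero k (X_sub_C_ne_zero a)),
      dvd_add_left (dvd_mul_right _ _), dvd_iff_isRoot, IsRoot.def, eval_mul, eval_mul, eval_C,
      mul_eq_zero, or_iff_left hy, mul_eq_zero, or_iff_right (by exact_mod_cast k.succ_ne_zero),
      ← IsRoot.def, ← dvd_iff_isRoot] at h
    rw [pow_succ _ (k + 1)]
    exact mul_dvd_mul_left _ h

end CommRing

section Degree

variable {R : Type*} [CommRing R] [IsDomain R] {κ : R} {p y : R[X]}

lemma degree_wronskian_lt_degree_C_mul (hκ : κ ≠ 0) (hp : p ≠ 0) (hy : y ≠ 0) :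
    (Polynomial.wronskian p y).degree < (C κ * (p * y)).degree := by
  rw [degree_C_mul hκ, degree_mul]
  exact degree_wronskian_lt_add hp hy

lemma natDegree_twistedWronskian (hκ : κ ≠ 0) (hp : p ≠ 0) (hy : y ≠ 0) :
    (twistedWronskian κ p y).natDegree = p.natDegree + y.natDegree := by
  rw [twistedWronskian_eq_sub_wronskian, natDegree_eq_of_degree_eq
    (degree_sub_eq_left_of_degree_lt (degree_wronskian_lt_degree_C_mul hκ hp hy)),
    natDegree_C_mul hκ, natDegree_mul hp hy]

lemma leadingCoeff_twistedWronskian (hκ : κ ≠ 0) (hp : p ≠ 0) (hy : y ≠ 0) :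
    (twistedWronskian κ p y).leadingCoeff = κ * (p.leadingCoeff * y.leadingCoeff) := by
  rw [twistedWronskian_eq_sub_wronskian, leadingCoeff_sub_of_degree_lt
    (degree_wronskian_lt_degree_C_mul hκ hp hy), leadingCoeff_mul, leadingCoeff_C,
    leadingCoeff_mul]

lemma twistedWronskian_ne_zero (hκ : κ ≠ 0) (hp : p ≠ 0) (hy : y ≠ 0) :
    twistedWronskian κ p y ≠ 0 := by
  rw [← leadingCoeff_ne_zero, leadingCoeff_twistedWronskian hκ hp hy]
  exact mul_ne_zero hκ (mul_ne_zero (leadingCoeff_ne_zero.2 hp) (leadingCoeff_ne_zero.2 hy))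

end Degree

section Field

variable {F : Type*} [Field F]

lemma exists_eq_C_mul_of_wronskian_eq_zero [CharZero F] {p q : F[X]} (hq : q ≠ 0)
    (h : Polynomial.wronskian p q = 0) : ∃ c : F, p = C c * q := by
  classical
  set g := EuclideanDomain.gcd p q
  obtain ⟨a, ha⟩ : g ∣ p := EuclideanDomain.gcd_dvd_left p q
  obtain ⟨b, hb⟩ : g ∣ q := EuclideanDomain.gcd_dvd_right p q
  have hg0 : g ≠ 0 := left_ne_zero_of_mul (hb ▸ hq)
  have hab : IsCoprime a b := by
    obtain ⟨u, v, huv⟩ : ∃ u v, g = p * u + q * v := ⟨_, _, EuclideanDomain.gcd_eq_gcd_ab p q⟩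
    exact ⟨u, v, mul_left_cancel₀ hg0 (by linear_combination -huv - u * ha - v * hb)⟩
  have hW : g ^ 2 * Polynomial.wronskian a b = 0 := by
    rw [← h, ha, hb]
    simp only [Polynomial.wronskian, derivative_mul]
    ring
  obtain ⟨ha', hb'⟩ := hab.wronskian_eq_zero_iff.1
    ((mul_eq_zero.1 hW).resolve_left (pow_ne_zero 2 hg0))
  rw [eq_C_of_derivative_eq_zero ha'] at ha
  rw [eq_C_of_derivative_eq_zero hb'] at hb
  have hb0 : b.coeff 0 ≠ 0 := fun h0 => hq (by rw [hb, h0, C_0, mul_zero])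
  refine ⟨a.coeff 0 / b.coeff 0, ?_⟩
  rw [ha, hb, mul_left_comm, ← C_mul, div_mul_cancel₀ _ hb0]

/-- The solution is the Neumann series `∑ (-1)^i κ^(-i-1) s^(i)`, a finite sum. -/
lemma exists_derivative_add_C_mul_eq {κ : F} (hκ : κ ≠ 0) (s : F[X]) :
    ∃ r : F[X], derivative r + C κ * r = s := by
  set a : ℕ → F[X] := fun i => C ((-κ⁻¹) ^ i) * derivative^[i] s with ha
  have hC : C κ * C κ⁻¹ = (1 : F[X]) := by rw [← C_mul, mul_inv_cancel₀ hκ, C_1]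
  have ha_deriv : ∀ i, C κ⁻¹ * derivative (a i) = -a (i + 1) := fun i => by
    simp only [ha, derivative_C_mul, Function.iterate_succ_apply', pow_succ, C_mul, C_neg]
    ring
  have ha_last : a (s.natDegree + 1) = 0 := by
    rw [ha]; simp only [iterate_derivative_eq_zero (Nat.lt_succ_self _), mul_zero]
  refine ⟨C κ⁻¹ * ∑ i ∈ Finset.range (s.natDegree + 1), a i, ?_⟩
  calc derivative (C κ⁻¹ * ∑ i ∈ Finset.range (s.natDegree + 1), a i)
        + C κ * (C κ⁻¹ * ∑ i ∈ Finset.range (s.natDegree + 1), a i)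
      = ∑ i ∈ Finset.range (s.natDegree + 1), (a i - a (i + 1)) := by
        rw [derivative_C_mul, derivative_sum, Finset.mul_sum, ← mul_assoc, hC, one_mul,
          ← Finset.sum_add_distrib]
        exact Finset.sum_congr rfl fun i _ => by rw [ha_deriv]; ring
    _ = s := by rw [Finset.sum_range_sub', ha_last]; simp [ha]

/-- For `y` with simple roots this is the polynomial form of the Bethe ansatz equations. By Bézout
`T` is `-p y'` modulo `y`, the hypothesis lifts this to a solution `p` modulo `y ^ 2`, and the
remaining multiple of `y ^ 2` is absorbed by adding to `p` a multiple of `y`. -/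
lemma exists_twistedWronskian_eq_iff {κ : F} (hκ : κ ≠ 0) {y : F[X]} (hy : y.Separable)
    (T : F[X]) : (∃ p, twistedWronskian κ p y = T) ↔ y ∣ twistedWronskian κ T (derivative y) := by
  refine ⟨?_, fun hT => ?_⟩
  · rintro ⟨p, rfl⟩
    exact ⟨_, twistedWronskian_twistedWronskian_derivative κ p y⟩
  obtain ⟨a, b, hab⟩ := hy
  set p₀ := -(T * b) with hp₀
  set e := T * a - derivative p₀ - C κ * p₀ with he
  have hsub : T = twistedWronskian κ p₀ y + y * e := by
    rw [he, twistedWronskian, hp₀]; linear_combination -T * hab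
  have hye : y ∣ derivative y * (derivative y * e) := by
    have hdvd : y ∣ twistedWronskian κ (y * e) (derivative y) := by
      rw [hsub, twistedWronskian_add_left, twistedWronskian_twistedWronskian_derivative] at hT
      exact (dvd_add_right (dvd_mul_right _ _)).1 hT
    rw [twistedWronskian, derivative_mul,
      show (derivative y * e + y * derivative e) * derivative y
          - y * e * derivative (derivative y) + C κ * (y * e) * derivative y
        = derivative y * (derivative y * e) + y * (derivative e * derivative y
          - e * derivative (derivative y) + C κ * e * derivative y) by ring] at hdvd
    exact (dvd_add_left (dvd_mul_right _ _)).1 hdvd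
  have hcop : IsCoprime y (derivative y) := ⟨a, b, hab⟩
  obtain ⟨s, hs⟩ := hcop.dvd_of_dvd_mul_left (hcop.dvd_of_dvd_mul_left hye)
  obtain ⟨r, hr⟩ := exists_derivative_add_C_mul_eq hκ s
  refine ⟨p₀ + y * r, ?_⟩
  rw [twistedWronskian_add_left, twistedWronskian_mul_self_left, hr, hsub, hs]
  ring

lemma eval_derivative_prod {ι : Type*} (s : Finset ι) (f : ι → F[X]) {x : F}
    (h : ∀ i ∈ s, (f i).eval x ≠ 0) :
    (derivative (∏ i ∈ s, f i)).eval x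
      = (∏ i ∈ s, f i).eval x * ∑ i ∈ s, (derivative (f i)).eval x / (f i).eval x := by
  classical
  rw [derivative_prod_finset, eval_finsetSum, Finset.mul_sum]
  refine Finset.sum_congr rfl fun i hi => ?_
  have hi0 := h i hi
  rw [← Finset.mul_prod_erase s f hi, eval_mul, eval_mul]
  field_simp

lemma nodal_dvd_iff {ι : Type*} [Fintype ι] {t : ι → F} (ht : Function.Injective t) {f : F[X]} :
    Lagrange.nodal Finset.univ t ∣ f ↔ ∀ i, f.eval (t i) = 0 := by
  refine ⟨fun h i => eval_eq_zero_of_dvd_of_eval_eq_zero h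
    (Lagrange.eval_nodal_at_node (Finset.mem_univ i)), fun h => ?_⟩
  rw [Lagrange.nodal_eq]
  exact Finset.prod_dvd_of_coprime ((pairwise_coprime_X_sub_C ht).set_pairwise _)
    fun i _ => dvd_iff_isRoot.2 (h i)

lemma eval_derivative_nodal_ne_zero {ι : Type*} [Fintype ι] {t : ι → F}
    (ht : Function.Injective t) (j : ι) :
    (derivative (Lagrange.nodal Finset.univ t)).eval (t j) ≠ 0 := by
  classical
  rw [Lagrange.eval_nodal_derivative_eval_node_eq (Finset.mem_univ j), Lagrange.eval_nodal]
  exact Finset.prod_ne_zero_iff.2 fun i hi => sub_ne_zero.2 (ht.ne (Finset.ne_of_mem_erase hi).symm)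

lemma eval_derivative_derivative_nodal {ι : Type*} [Fintype ι] [DecidableEq ι] {t : ι → F}
    (ht : Function.Injective t) (j : ι) :
    (derivative (derivative (Lagrange.nodal Finset.univ t))).eval (t j)
      = (derivative (Lagrange.nodal Finset.univ t)).eval (t j)
        * ∑ i ∈ {j}ᶜ, 2 / (t j - t i) := by
  have hne : ∀ i ∈ Finset.univ.erase j, (X - C (t i)).eval (t j) ≠ 0 := fun i hi => by
    rw [eval_sub, eval_X, eval_C]
    exact sub_ne_zero.2 (ht.ne (Finset.ne_of_mem_erase hi).symm)
  have htwice : (derivative (derivative (Lagrange.nodal Finset.univ t))).eval (t j)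
      = 2 * (derivative (Lagrange.nodal (Finset.univ.erase j) t)).eval (t j) := by
    rw [Lagrange.nodal_eq_mul_nodal_erase (Finset.mem_univ j)]
    simp only [derivative_mul, derivative_sub, derivative_X, derivative_C, derivative_add,
      eval_add, eval_mul, eval_sub, eval_X, eval_C, eval_one, sub_self, sub_zero]
    simp only [derivative_one, eval_zero]
    ring
  rw [htwice, Lagrange.eval_nodal_derivative_eval_node_eq (Finset.mem_univ j), Lagrange.nodal_eq,
    eval_derivative_prod _ _ hne, ← Finset.compl_singleton, mul_left_comm, Finset.mul_sum]
  congr 1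
  refine Finset.sum_congr rfl fun i _ => ?_
  rw [derivative_X_sub_C, eval_one, eval_sub, eval_X, eval_C, mul_one_div]

end Field

end TwistedWronskian

section FusionPoly

section CommRing

variable {R ι : Type*} [CommRing R] [Fintype ι]

/-- The polynomial `∏ (x - z_a) ^ (m_a)`, the Wronskian of a space of the `(μ, z, n, m)`-type up to
an exponential factor. -/
def fusionPoly (z : ι → R) (m : ι → ℕ) : R[X] := ∏ a, (X - C (z a)) ^ m a

lemma monic_fusionPoly (z : ι → R) (m : ι → ℕ) : (fusionPoly z m).Monic :=
  monic_prod_of_monic _ _ fun a _ => (monic_X_sub_C (z a)).pow _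

lemma natDegree_fusionPoly [Nontrivial R] (z : ι → R) (m : ι → ℕ) :
    (fusionPoly z m).natDegree = ∑ a, m a := by
  simp [fusionPoly, natDegree_prod_of_monic _ _ fun a _ => (monic_X_sub_C (z a)).pow _,
    (monic_X_sub_C _).natDegree_pow]

lemma eval_fusionPoly (z : ι → R) (m : ι → ℕ) (x : R) :
    (fusionPoly z m).eval x = ∏ a, (x - z a) ^ m a := by
  simp [fusionPoly, eval_prod]

lemma eval_fusionPoly_ne_zero_iff [IsDomain R] {z : ι → R} {m : ι → ℕ} {x : R} :
    (fusionPoly z m).eval x ≠ 0 ↔ ∀ a, m a ≠ 0 → x ≠ z a := by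
  simp only [eval_fusionPoly, Finset.prod_ne_zero_iff, Finset.mem_univ, true_implies, ne_eq,
    pow_eq_zero_iff', sub_eq_zero, not_and, not_not, imp_not_comm]

end CommRing

section Field

variable {F ι : Type*} [Field F] [Fintype ι]

lemma isCoprime_fusionPoly {z : ι → F} (m : ι → ℕ) {y : F[X]}
    (hy : ∀ a, y.eval (z a) ≠ 0) : IsCoprime y (fusionPoly z m) :=
  IsCoprime.prod_right fun a _ => IsCoprime.pow_right <|
    ((irreducible_X_sub_C (z a)).coprime_iff_not_dvd.2 fun h => hy a (dvd_iff_isRoot.1 h)).symm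

lemma fusionPoly_dvd {z : ι → F} {m : ι → ℕ} (hz : Function.Injective z) {W : F[X]}
    (h : ∀ a, (X - C (z a)) ^ m a ∣ W) : fusionPoly z m ∣ W :=
  Finset.prod_dvd_of_coprime (fun _ _ _ _ hab => (pairwise_coprime_X_sub_C hz hab).pow)
    fun a _ => h a

lemma eval_derivative_fusionPoly {z : ι → F} {m : ι → ℕ} {x : F}
    (h : (fusionPoly z m).eval x ≠ 0) :
    (derivative (fusionPoly z m)).eval x
      = (fusionPoly z m).eval x * ∑ a, (m a : F) / (x - z a) := by
  have hne : ∀ a ∈ Finset.univ, ((X - C (z a)) ^ m a).eval x ≠ 0 := by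
    rw [fusionPoly, eval_prod] at h
    exact Finset.prod_ne_zero_iff.1 h
  rw [fusionPoly, eval_derivative_prod _ _ hne]
  congr 1
  refine Finset.sum_congr rfl fun a _ => ?_
  rcases Nat.eq_zero_or_pos (m a) with h0 | h0
  · simp [h0]
  · have hx : x - z a ≠ 0 := sub_ne_zero.2 (eval_fusionPoly_ne_zero_iff.1 h a h0.ne')
    obtain ⟨k, hk⟩ := Nat.exists_eq_add_of_lt h0
    rw [hk, zero_add, derivative_X_sub_C_pow]
    simp only [Nat.add_sub_cancel, eval_mul, eval_pow, eval_sub, eval_X, eval_C]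
    field_simp
    rw [pow_succ', mul_assoc]

end Field

end FusionPoly

section Roots

lemma exists_injective_eq_C_mul_nodal {F : Type*} [Field F] [IsAlgClosed F] {y : F[X]}
    (hy : y.Separable) : ∃ t : Fin y.natDegree → F, Function.Injective t ∧
      y = C y.leadingCoeff * Lagrange.nodal Finset.univ t := by
  classical
  have hcard : y.roots.toFinset.card = y.natDegree := by
    rw [Multiset.toFinset_card_of_nodup (nodup_roots hy), IsAlgClosed.card_roots_eq_natDegree]
  set e := (y.roots.toFinset.equivFinOfCardEq hcard).symm
  refine ⟨fun j => e j, Subtype.val_injective.comp e.injective, ?_⟩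
  have hprod : Lagrange.nodal Finset.univ (fun j => (e j : F))
      = (y.roots.map fun a => X - C a).prod := by
    rw [Lagrange.nodal_eq, e.prod_comp fun a => X - C (a : F),
      Finset.prod_coe_sort y.roots.toFinset fun a => X - C a, Finset.prod,
      Multiset.toFinset_val, (nodup_roots hy).dedup]
  rw [hprod]
  exact (IsAlgClosed.splits y).eq_prod_roots

end Roots

section LogFDeriv

variable {𝕜 E : Type*} [NontriviallyNormedField 𝕜] [NormedAddCommGroup E] [NormedSpace 𝕜 E]

/-- The logarithmic derivative of `f` at `x` is `A`, written without division: `df = f A` at `x`. -/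
def HasLogFDerivAt (f : E → 𝕜) (A : E →L[𝕜] 𝕜) (x : E) : Prop := HasFDerivAt f (f x • A) x

lemma hasLogFDerivAt_const (c : 𝕜) (x : E) :
    HasLogFDerivAt (fun _ : E => c) (0 : E →L[𝕜] 𝕜) x :=
  (hasFDerivAt_const c x).congr_fderiv (smul_zero (A := E →L[𝕜] 𝕜) c).symm

lemma HasLogFDerivAt.mul {f g : E → 𝕜} {A B : E →L[𝕜] 𝕜} {x : E} (hf : HasLogFDerivAt f A x)
    (hg : HasLogFDerivAt g B x) : HasLogFDerivAt (fun x => f x * g x) (A + B) x := by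
  refine (HasFDerivAt.mul hf hg).congr_fderiv ?_
  simp only [smul_add, smul_smul, mul_comm (g x) (f x), add_comm]

lemma HasLogFDerivAt.finsetProd {ι : Type*} {s : Finset ι} {f : ι → E → 𝕜}
    {A : ι → E →L[𝕜] 𝕜} {x : E} (hf : ∀ i ∈ s, HasLogFDerivAt (f i) (A i) x) :
    HasLogFDerivAt (fun x => ∏ i ∈ s, f i x) (∑ i ∈ s, A i) x := by
  classical
  induction s using Finset.induction_on with
  | empty => simpa only [Finset.prod_empty, Finset.sum_empty] using hasLogFDerivAt_const (1 : 𝕜) x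
  | insert a s ha ih =>
    simp only [Finset.prod_insert ha, Finset.sum_insert ha]
    exact (hf a (Finset.mem_insert_self a s)).mul
      (ih fun i hi => hf i (Finset.mem_insert_of_mem hi))

lemma hasLogFDerivAt_zpow {f : E → 𝕜} {A : E →L[𝕜] 𝕜} {x : E}
    (hf : HasFDerivAt f A x) {n : ℤ} (h : n ≠ 0 → f x ≠ 0) :
    HasLogFDerivAt (fun x => f x ^ n) (((n : 𝕜) / f x) • A) x := by
  rcases eq_or_ne n 0 with rfl | hn
  · simp only [zpow_zero, Int.cast_zero, zero_div]
    convert hasLogFDerivAt_const (1 : 𝕜) x using 1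
    exact zero_smul 𝕜 A
  · refine ((hasDerivAt_zpow n (f x) (Or.inl (h hn))).comp_hasFDerivAt x hf).congr_fderiv ?_
    rw [smul_smul, zpow_sub_one₀ (h hn)]
    congr 1
    ring

lemma hasLogFDerivAt_cexp {E : Type*} [NormedAddCommGroup E] [NormedSpace ℂ E]
    {f : E → ℂ} {A : E →L[ℂ] ℂ} {x : E} (hf : HasFDerivAt f A x) :
    HasLogFDerivAt (fun x => Complex.exp (f x)) A x :=
  hf.cexp

end LogFDeriv

section BetheAnsatz

/-- The left hand side of the `j`-th Bethe ansatz equation, the logarithmic derivative of the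
master function with respect to `t_j`. -/
def betheExpr {k : ℕ} (mu z : Fin 2 → ℂ) (m : Fin 2 → ℕ) (t : Fin k → ℂ) (j : Fin k) : ℂ :=
  (mu 1 - mu 0) - ∑ a, (m a : ℂ) / (t j - z a) + ∑ i ∈ {j}ᶜ, 2 / (t j - t i)

variable {k : ℕ} {mu z : Fin 2 → ℂ} {m : Fin 2 → ℕ} {t : Fin k → ℂ}

lemma betheExpr_eq_zero_iff (ht : Function.Injective t) {j : Fin k}
    (hj : ∀ a, m a ≠ 0 → t j ≠ z a) :
    betheExpr mu z m t j = 0 ↔ (twistedWronskian (mu 0 - mu 1) (fusionPoly z m)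
      (derivative (Lagrange.nodal Finset.univ t))).eval (t j) = 0 := by
  have hT : (fusionPoly z m).eval (t j) ≠ 0 := eval_fusionPoly_ne_zero_iff.2 hj
  set T := (fusionPoly z m).eval (t j)
  set y' := (derivative (Lagrange.nodal Finset.univ t)).eval (t j)
  have hfactor : (twistedWronskian (mu 0 - mu 1) (fusionPoly z m)
      (derivative (Lagrange.nodal Finset.univ t))).eval (t j)
        = -(T * y') * betheExpr mu z m t j := by
    simp only [twistedWronskian, eval_add, eval_sub, eval_mul, eval_C, betheExpr,
      eval_derivative_fusionPoly hT, eval_derivative_derivative_nodal ht j]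
    ring
  rw [hfactor, mul_eq_zero,
    or_iff_right (neg_ne_zero.2 (mul_ne_zero hT (eval_derivative_nodal_ne_zero ht j)))]

lemma isAdmissible_iff (hz : z 0 ≠ z 1) :
    IsAdmissible mu z m t ↔ (∀ j a, m a ≠ 0 → t j ≠ z a) ∧ Function.Injective t := by
  refine and_congr_right fun h => ?_
  have hpow : ∀ j a, (t j - z a) ^ (-(m a : ℤ)) ≠ 0 := fun j a => by
    rcases eq_or_ne (m a) 0 with h0 | h0
    · simp [h0]
    · exact zpow_ne_zero _ (sub_ne_zero.2 (h j a h0))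
  have hprefactor := mul_ne_zero (mul_ne_zero (Complex.exp_ne_zero (mu 0 * (m 0 * z 0 + m 1 * z 1)
    + (mu 1 - mu 0) * ∑ j, t j)) (pow_ne_zero (m 0 * m 1) (sub_ne_zero.2 hz)))
    (Finset.prod_ne_zero_iff.2 fun j (_ : j ∈ Finset.univ) => mul_ne_zero (hpow j 0) (hpow j 1))
  simp only [masterFunction, mul_ne_zero_iff.trans (and_iff_right hprefactor),
    Finset.prod_ne_zero_iff, Finset.mem_univ, Finset.mem_Ioi, true_implies,
    pow_ne_zero_iff two_ne_zero, sub_ne_zero]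
  refine ⟨fun H i j hij => ?_, fun H i j hlt => H.ne hlt.ne⟩
  rcases lt_trichotomy i j with hlt | heq | hlt
  exacts [absurd hij (H i j hlt), heq, absurd hij.symm (H j i hlt)]

lemma hasLogFDerivAt_masterFunction (h : ∀ j a, m a ≠ 0 → t j ≠ z a) (ht : Function.Injective t) :
    HasLogFDerivAt (masterFunction mu z m)
      (∑ j, betheExpr mu z m t j • (ContinuousLinearMap.proj j : (Fin k → ℂ) →L[ℂ] ℂ)) t := by
  set pr : Fin k → ((Fin k → ℂ) →L[ℂ] ℂ) := fun j => ContinuousLinearMap.proj j with hpr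
  have hpr_deriv : ∀ j, HasFDerivAt (fun t : Fin k → ℂ => t j) (pr j) t := fun j =>
    (pr j).hasFDerivAt
  have hexp : HasLogFDerivAt (fun t : Fin k → ℂ =>
      Complex.exp (mu 0 * (m 0 * z 0 + m 1 * z 1) + (mu 1 - mu 0) * ∑ j, t j))
      ((mu 1 - mu 0) • ∑ j, pr j) t :=
    hasLogFDerivAt_cexp (((HasFDerivAt.fun_sum fun j _ => hpr_deriv j).const_mul _).const_add _)
  have hpole : ∀ j a, HasLogFDerivAt (fun t : Fin k → ℂ => (t j - z a) ^ (-(m a : ℤ)))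
      ((((-(m a : ℤ) : ℤ) : ℂ) / (t j - z a)) • pr j) t := fun j a =>
    hasLogFDerivAt_zpow ((hpr_deriv j).sub_const (z a)) fun ha =>
      sub_ne_zero.2 (h j a (by simpa using ha))
  have hdiff : ∀ j, ∀ j' ∈ Finset.Ioi j, HasLogFDerivAt (fun t : Fin k → ℂ => (t j - t j') ^ 2)
      ((2 / (t j - t j')) • pr j + (2 / (t j' - t j)) • pr j') t := fun j j' hj => by
    have hne : t j - t j' ≠ 0 := sub_ne_zero.2 (ht.ne (Finset.mem_Ioi.1 hj).ne)
    have hsq := hasLogFDerivAt_zpow ((hpr_deriv j).fun_sub (hpr_deriv j')) (n := 2) fun _ => hne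
    convert hsq using 1
    · exact funext fun t => (zpow_ofNat _ 2).symm
    rw [smul_sub, Int.cast_ofNat, ← neg_sub (t j), div_neg,
      neg_smul _ (pr j'), ← sub_eq_add_neg]
  have hall := ((hexp.mul (hasLogFDerivAt_const ((z 0 - z 1) ^ (m 0 * m 1)) t)).mul
    (HasLogFDerivAt.finsetProd (s := Finset.univ) fun j _ => (hpole j 0).mul (hpole j 1))).mul
    (HasLogFDerivAt.finsetProd (s := Finset.univ) fun j _ => HasLogFDerivAt.finsetProd (hdiff j))
  convert hall using 1
  · rfl
  rw [Finset.sum_sum_Ioi_add_eq_sum_sum_off_diag fun i j => (2 / (t j - t i)) • pr j, add_zero,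
    Finset.smul_sum, ← Finset.sum_add_distrib, ← Finset.sum_add_distrib]
  refine Finset.sum_congr rfl fun j _ => ?_
  ext v
  simp only [betheExpr, hpr, add_apply, smul_apply, sum_apply, smul_eq_mul, ← Finset.sum_mul,
    Fin.sum_univ_two]
  push_cast
  ring

lemma isCriticalPoint_iff (hz : z 0 ≠ z 1) (hA : IsAdmissible mu z m t) :
    IsCriticalPoint mu z m t ↔ ∀ j, betheExpr mu z m t j = 0 := by
  obtain ⟨h, ht⟩ := (isAdmissible_iff hz).1 hA
  have hF := hasLogFDerivAt_masterFunction (mu := mu) h ht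
  refine ⟨fun H j => ?_, fun H => HasFDerivAt.congr_fderiv hF (by ext v; simp [H])⟩
  have happly := congrArg (fun L : (Fin k → ℂ) →L[ℂ] ℂ => L (Pi.single j 1)) (hF.unique H)
  simpa [hA.2, Pi.single_apply] using happly

lemma isCriticalPoint_iff_exists_twistedWronskian_eq (hmu : mu 0 ≠ mu 1) (hz : z 0 ≠ z 1)
    (hA : IsAdmissible mu z m t) : IsCriticalPoint mu z m t ↔
      ∃ p, twistedWronskian (mu 0 - mu 1) p (Lagrange.nodal Finset.univ t) = fusionPoly z m := by
  obtain ⟨h, ht⟩ := (isAdmissible_iff hz).1 hA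
  have hsep : (Lagrange.nodal Finset.univ t).Separable := by
    rw [Lagrange.nodal_eq]
    exact separable_prod_X_sub_C_iff.2 ht
  rw [isCriticalPoint_iff hz hA, exists_twistedWronskian_eq_iff (sub_ne_zero.2 hmu) hsep,
    nodal_dvd_iff ht]
  exact forall_congr' fun j => betheExpr_eq_zero_iff ht (h j)

lemma representsAdmissibleCriticalPoint_of_twistedWronskian_eq {p y : ℂ[X]} {c : ℂ}
    (hmu : mu 0 ≠ mu 1) (hz : z 0 ≠ z 1) (hc : c ≠ 0)
    (h : twistedWronskian (mu 0 - mu 1) p y = C c * fusionPoly z m)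
    (hy : ∀ a, y.eval (z a) ≠ 0) (hk : y.natDegree = k) :
    RepresentsAdmissibleCriticalPoint k mu z m y := by
  have hcop : IsCoprime y (C c * fusionPoly z m) :=
    (isCoprime_mul_unit_left_right (isUnit_C.2 hc.isUnit) _ _).2 (isCoprime_fusionPoly m hy)
  obtain ⟨t, ht, hyt⟩ :=
    hk ▸ exists_injective_eq_C_mul_nodal (separable_of_twistedWronskian_eq h hcop)
  have hlead : y.leadingCoeff ≠ 0 := leadingCoeff_ne_zero.2 fun h0 => hy 0 (by rw [h0, eval_zero])
  have hroot : ∀ j, y.eval (t j) = 0 := fun j => by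
    rw [hyt, eval_mul, Lagrange.eval_nodal_at_node (Finset.mem_univ j), mul_zero]
  have hA : IsAdmissible mu z m t :=
    (isAdmissible_iff hz).2 ⟨fun j a _ hja => hy a (hja ▸ hroot j), ht⟩
  refine ⟨⟨t, ⟨_, hlead, Lagrange.nodal_eq Finset.univ t ▸ hyt⟩, hA,
    (isCriticalPoint_iff_exists_twistedWronskian_eq hmu hz hA).2
      ⟨C (y.leadingCoeff * c⁻¹) * p, ?_⟩⟩, hy⟩
  have hscaled : C y.leadingCoeff * twistedWronskian (mu 0 - mu 1) p (Lagrange.nodal Finset.univ t)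
      = C c * fusionPoly z m := by rw [← twistedWronskian_C_mul_right, ← hyt, h]
  rw [twistedWronskian_C_mul_left, mul_comm y.leadingCoeff, C_mul, mul_assoc, hscaled, ← mul_assoc,
    ← C_mul, inv_mul_cancel₀ hc, C_1, one_mul]

end BetheAnsatz

section Valuation

lemma exists_eq_mul_C_of_map_eq {R S : Type*} [CommRing R] [CommRing S] [IsDomain S] {f : R →+* S}
    (hf : Function.Injective f) {T W : R[X]} (hT : T.Monic) {c : S}
    (h : W.map f = T.map f * C c) : ∃ d, W = T * C d := by
  obtain ⟨D, rfl⟩ : T ∣ W := by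
    rw [← Polynomial.map_dvd_map f hf hT, h]
    exact dvd_mul_right _ _
  rw [Polynomial.map_mul] at h
  have hD : D.map f = C c := mul_left_cancel₀ (hT.map f).ne_zero h
  refine ⟨D.coeff 0, ?_⟩
  rw [← eq_C_of_natDegree_eq_zero]
  rw [← natDegree_map_eq_of_injective hf, hD, natDegree_C]

variable {K : Type*} [Field K]

lemma exists_map_subtype_eq_C_mul (O : ValuationSubring K) {p : K[X]} (hp : p ≠ 0) :
    ∃ (c : K) (P : O[X]), P.map O.subtype = C c * p ∧ P.map (IsLocalRing.residue O) ≠ 0 := by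
  obtain ⟨i, hi, hmax⟩ := p.support.exists_max_image (fun j => O.valuation (p.coeff j))
    (support_nonempty.2 hp)
  have hpi : p.coeff i ≠ 0 := mem_support_iff.1 hi
  have hcoeff (j : ℕ) : (p.coeff i)⁻¹ * p.coeff j ∈ O := by
    by_cases hj : j ∈ p.support
    · rw [← O.valuation_le_one_iff, map_mul, map_inv₀]
      exact inv_mul_le_one_of_le₀ (hmax j hj) zero_le
    · rw [notMem_support_iff.1 hj, mul_zero]
      exact O.zero_mem
  obtain ⟨P, hP⟩ : C (p.coeff i)⁻¹ * p ∈ lifts O.subtype :=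
    (lifts_iff_coeff_lifts _).2 fun j => ⟨⟨_, hcoeff j⟩, (coeff_C_mul p).symm⟩
  rw [coe_mapRingHom] at hP
  refine ⟨(p.coeff i)⁻¹, P, hP, fun h => ?_⟩
  have hPi : P.coeff i = 1 := Subtype.ext <| by
    simpa [hpi] using congrArg (fun f => f.coeff i) hP
  simpa [hPi] using congrArg (fun f => f.coeff i) h

/-- Scale `p` and `y` to primitive polynomials over the valuation ring. As `κ⁻¹` reduces to zero,
the reduction of `κ⁻¹ * twistedWronskian κ p y` is the product of the reductions, which is not
zero and vanishes at the origin to order at least `k + 1`. -/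
lemma twistedWronskian_ne_of_inv_mem_nonunits (O : ValuationSubring K) {κ : K} (hκ : κ ≠ 0)
    (hO : κ⁻¹ ∈ O.nonunits) {k : ℕ} (l : ℕ) {p : K[X]} (hp : X ^ (k + 1) ∣ p) (y : K[X]) :
    twistedWronskian κ p y ≠ X ^ k * (X - 1) ^ l := by
  intro h
  have hX : (X - 1 : K[X]).Monic := monic_X_sub_C 1
  have hT : (X ^ k * (X - 1) ^ l : K[X]).Monic := (monic_X_pow k).mul (hX.pow l)
  have hp0 : p ≠ 0 := by rintro rfl; exact hT.ne_zero (by simp [← h, twistedWronskian])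
  have hy0 : y ≠ 0 := by rintro rfl; exact hT.ne_zero (by simp [← h, twistedWronskian])
  obtain ⟨a, P, hP, hPres⟩ := exists_map_subtype_eq_C_mul O hp0
  obtain ⟨b, Y, hY, hYres⟩ := exists_map_subtype_eq_C_mul O hy0
  obtain ⟨hκO, hκres⟩ := ValuationSubring.mem_nonunits_iff_exists_mem_maximalIdeal.1 hO
  set W : O[X] := C ⟨κ⁻¹, hκO⟩ * (derivative P * Y - P * derivative Y) + P * Y with hW
  have hWmap : W.map O.subtype = X ^ k * (X - 1) ^ l * C (κ⁻¹ * (a * b)) := by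
    have hκC : C κ⁻¹ * C κ = (1 : K[X]) := by rw [← C_mul, inv_mul_cancel₀ hκ, C_1]
    rw [← h, hW]
    simp only [Polynomial.map_add, Polynomial.map_mul, Polynomial.map_sub, map_C,
      ValuationSubring.subtype_apply, ← derivative_map, hP, hY, derivative_C_mul,
      twistedWronskian, C_mul]
    linear_combination -(C a * C b * p * y) * hκC
  obtain ⟨d, hd⟩ : ∃ d, W = X ^ k * (X - 1) ^ l * C d :=
    exists_eq_mul_C_of_map_eq Subtype.val_injective
      ((monic_X_pow k).mul ((monic_X_sub_C 1).pow l))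
      (hWmap.trans (by simp [-mul_eq_mul_left_iff] : _ = _ * C (κ⁻¹ * (a * b))))
  obtain ⟨Q, hQ⟩ : X ^ (k + 1) ∣ P := by
    rw [← Polynomial.map_dvd_map O.subtype Subtype.val_injective (monic_X_pow _), hP]
    simpa using hp.mul_left (C a)
  set r := IsLocalRing.residue O
  have hres : P.map r * Y.map r = X ^ k * (X - 1) ^ l * C (r d) := by
    have hκr : r ⟨κ⁻¹, hκO⟩ = 0 := (IsLocalRing.residue_eq_zero_iff _).2 hκres
    have := congrArg (Polynomial.map r) (hW.symm.trans hd)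
    simpa [hκr] using this
  have hcancel : X * (Q.map r * Y.map r) = (X - 1) ^ l * C (r d) :=
    mul_left_cancel₀ (pow_ne_zero k X_ne_zero) (by
      rw [← mul_assoc (X ^ k) _ (C (r d)), ← hres, hQ]
      simp only [Polynomial.map_mul, Polynomial.map_pow, map_X]
      ring)
  have hrd : r d = 0 := by simpa using (congrArg (eval 0) hcancel).symm
  rw [hrd, C_0, mul_zero] at hres
  exact mul_ne_zero hPres hYres hres

lemma exists_valuationSubring_mem_nonunits {F : Type*} [Field F] (φ : F[X] →+* K)
    (hφ : Function.Injective φ) : ∃ O : ValuationSubring K, φ X ∈ O.nonunits := by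
  set x : φ.range := ⟨φ X, X, rfl⟩
  have hI : Ideal.span {x} ≠ ⊤ := by
    rw [Ne, Ideal.span_singleton_eq_top]
    intro hu
    obtain ⟨⟨_, f, rfl⟩, hf⟩ := isUnit_iff_exists_inv.1 hu
    have hXf : X * f = 1 := hφ (by rw [map_mul, map_one]; exact congrArg Subtype.val hf)
    exact not_isUnit_X (IsUnit.of_mul_eq_one f hXf)
  obtain ⟨O, -, hO⟩ := Ideal.image_subset_nonunits_valuationSubring _ hI
  exact ⟨O, hO ⟨x, Ideal.subset_span rfl, rfl⟩⟩

end Valuation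

section Generic

variable {F : Type*} [Field F]

/-- The values of `(λ₁ - λ₂) (z₁ - z₂)` that are excluded for exponents `k` and `l`: those `κ` for
which `twistedWronskian κ p y = x ^ k * (x - 1) ^ l` has a solution such that the exponent of
`p` at the origin is `k + 1` rather than `0`. The points `z₁`, `z₂` are moved to `0`, `1`. -/
def nongenericSet (k l : ℕ) : Set F :=
  {κ | κ ≠ 0 ∧ ∃ p y : F[X], X ^ (k + 1) ∣ p ∧ twistedWronskian κ p y = X ^ k * (X - 1) ^ l}

lemma exists_polynomial_pi {ι R : Type*} [CommRing R] (f : ι → R[X]) {d : ℕ}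
    (hf : ∀ i, (f i).natDegree ≤ d) :
    ∃ F : (ι → R)[X], ∀ i, F.map (Pi.evalRingHom (fun _ => R) i) = f i := by
  refine ⟨∑ j ∈ Finset.range (d + 1), C (fun i => (f i).coeff j) * X ^ j, fun i => ?_⟩
  rw [(f i).as_sum_range_C_mul_X_pow' (Nat.lt_succ_of_le (hf i))]
  simp [Polynomial.map_sum]

lemma polynomial_pi_ext {ι R : Type*} [CommRing R] {f g : (ι → R)[X]}
    (h : ∀ i, f.map (Pi.evalRingHom (fun _ => R) i) = g.map (Pi.evalRingHom (fun _ => R) i)) :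
    f = g := by
  ext n i
  simpa [coeff_map] using congrArg (fun p => p.coeff n) (h i)

lemma injective_germ_comp_aeval {B : Type*} [Infinite B] {f : B → F}
    (hf : Function.Injective f) : Function.Injective ((Filter.Germ.coeRingHom
      (Filter.hyperfilter B : Filter B)).comp (aeval (R := F) f).toRingHom) := by
  rw [injective_iff_map_eq_zero]
  intro p hp
  by_contra hp0
  have hzero : {b | p.eval (f b) = 0} ∈ Filter.hyperfilter B := by
    filter_upwards [Filter.Germ.coe_eq.1 hp] with b hb
    have := aeval_algHom_apply (Pi.evalAlgHom F (fun _ : B => F) b) f p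
    rw [Pi.evalAlgHom_apply, coe_aeval_eq_eval] at this
    exact this.trans hb
  refine Set.Finite.notMem_hyperfilter ?_ hzero
  exact (p.rootSet_finite F).preimage hf.injOn |>.subset fun b hb => by
    simpa [mem_rootSet, hp0] using hb

lemma exists_natDegree_le_of_mem_nongenericSet {k l : ℕ} {κ : F} (hκ : κ ∈ nongenericSet k l) :
    ∃ q y : F[X], q.natDegree ≤ k + l ∧ y.natDegree ≤ k + l ∧
      twistedWronskian κ (X ^ (k + 1) * q) y = X ^ k * (X - 1) ^ l := by
  obtain ⟨hκ0, _, y, ⟨q, rfl⟩, h⟩ := hκ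
  have hX : (X - 1 : F[X]).Monic := monic_X_sub_C 1
  have hT : (X ^ k * (X - 1) ^ l : F[X]) ≠ 0 := ((monic_X_pow k).mul (hX.pow l)).ne_zero
  have hTdeg : (X ^ k * (X - 1) ^ l : F[X]).natDegree ≤ k + l := by
    compute_degree
  have hq0 : q ≠ 0 := by rintro rfl; exact hT (by simp [← h, twistedWronskian])
  have hy0 : y ≠ 0 := by rintro rfl; exact hT (by simp [← h, twistedWronskian])
  rw [← h, natDegree_twistedWronskian hκ0 (mul_ne_zero (pow_ne_zero _ X_ne_zero) hq0) hy0,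
    (monic_X_pow _).natDegree_mul' hq0, natDegree_X_pow] at hTdeg
  exact ⟨q, y, by omega, by omega, h⟩

/-- Infinitely many elements would yield, in an ultraproduct of copies of `F`, a solution of the
same equation for some `κ` transcendental over `F`, hence infinitely large for a valuation. -/
lemma finite_nongenericSet (k l : ℕ) : (nongenericSet k l : Set F).Finite := by
  by_contra hinf
  set B : Set F := nongenericSet k l
  have : Infinite B := Set.infinite_coe_iff.2 hinf
  have hB0 (b : B) : (b : F) ≠ 0 := b.2.1
  choose q y hq hy h using fun b : B => exists_natDegree_le_of_mem_nongenericSet b.2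
  obtain ⟨Q, hQ⟩ := exists_polynomial_pi q hq
  obtain ⟨Y, hY⟩ := exists_polynomial_pi y hy
  have hQY : twistedWronskian (fun b : B => (b : F)) (X ^ (k + 1) * Q) Y
      = X ^ k * (X - 1) ^ l := by
    refine polynomial_pi_ext fun b => ?_
    rw [twistedWronskian_map, Polynomial.map_mul, hQ, hY]
    simpa using h b
  set inv : B → F := fun b => (b : F)⁻¹
  set ψ := Filter.Germ.coeRingHom (R := F) (Filter.hyperfilter B : Filter B) with hψ
  have hinj : Function.Injective inv := inv_injective.comp Subtype.val_injective
  obtain ⟨O, hO⟩ := exists_valuationSubring_mem_nonunits _ (injective_germ_comp_aeval hinj)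
  have hmul : ψ (fun b => (b : F)) * ψ inv = 1 := by
    rw [← map_mul, ← map_one ψ]
    exact congrArg ψ (funext fun b => mul_inv_cancel₀ (hB0 b))
  have hdvd : X ^ (k + 1) ∣ X ^ (k + 1) * Q.map ψ := dvd_mul_right _ _
  refine twistedWronskian_ne_of_inv_mem_nonunits O (left_ne_zero_of_mul_eq_one hmul)
    ?_ l hdvd (Y.map ψ) ?_
  · rw [← eq_inv_of_mul_eq_one_right hmul]
    have hX : aeval inv (X : F[X]) = inv := aeval_X inv
    simpa [← hψ, -Filter.Germ.coe_coeRingHom] using hX ▸ hO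
  · simpa [twistedWronskian_map] using congrArg (Polynomial.map ψ) hQY

lemma mul_sub_mem_nongenericSet {κ a b c : F} {k l : ℕ} {p y : F[X]} (hκ : κ ≠ 0) (hab : a ≠ b)
    (hc : c ≠ 0) (h : twistedWronskian κ p y = C c * ((X - C a) ^ k * (X - C b) ^ l))
    (hp : (X - C a) ^ (k + 1) ∣ p) : κ * (b - a) ∈ nongenericSet k l := by
  have hba : b - a ≠ 0 := sub_ne_zero.2 hab.symm
  set r : F[X] := C (b - a) * X + C a with hr
  have hra : (X - C a).comp r = C (b - a) * X := by simp [hr]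
  have hrb : (X - C b).comp r = C (b - a) * (X - 1) := by
    simp only [hr, sub_comp, X_comp, C_comp, C_sub]
    ring
  have hdvd : X ^ (k + 1) ∣ p.comp r := by
    obtain ⟨q, rfl⟩ := hp
    rw [mul_comp, pow_comp, hra, mul_pow]
    exact (dvd_mul_left _ _).mul_right _
  obtain ⟨d, hd⟩ : ∃ d, d = (b - a) * (c * ((b - a) ^ k * (b - a) ^ l)) := ⟨_, rfl⟩
  have hd0 : d ≠ 0 := hd ▸
    mul_ne_zero hba (mul_ne_zero hc (mul_ne_zero (pow_ne_zero k hba) (pow_ne_zero l hba)))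
  have hcomp := twistedWronskian_comp_affine κ (b - a) a p y
  rw [← hr, h, mul_comp, mul_comp, C_comp, pow_comp, pow_comp, hra, hrb] at hcomp
  refine ⟨mul_ne_zero hκ hba, C d⁻¹ * p.comp r, y.comp r,
    hdvd.mul_left _, ?_⟩
  have hdC : C d⁻¹ * C d = (1 : F[X]) := by rw [← C_mul, inv_mul_cancel₀ hd0, C_1]
  rw [twistedWronskian_C_mul_left, hcomp]
  simp only [hd, C_mul, C_pow, mul_pow] at hdC ⊢
  linear_combination X ^ k * (X - 1) ^ l * hdC

end Generic

section FinTwo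

lemma add_one_ne_self_fin_two (a : Fin 2) : a + 1 ≠ a := by
  fin_cases a <;> simp

lemma injective_fin_two {α : Type*} {f : Fin 2 → α} (hf : f 0 ≠ f 1) : Function.Injective f := by
  intro i j h
  fin_cases i <;> fin_cases j <;> simp_all [eq_comm]

lemma prod_fin_two_eq_mul {M : Type*} [CommMonoid M] (f : Fin 2 → M) (a : Fin 2) :
    ∏ b, f b = f a * f (a + 1) := by
  rw [Fin.prod_univ_two]
  fin_cases a
  · rfl
  · exact mul_comm _ _

lemma fusionPoly_eq_mul {R : Type*} [CommRing R] (z : Fin 2 → R) (m : Fin 2 → ℕ) (a : Fin 2) :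
    fusionPoly z m = (X - C (z a)) ^ m a * (X - C (z (a + 1))) ^ m (a + 1) :=
  prod_fin_two_eq_mul _ a

/-- Exponents `mu` and points `z` are generic for the multiplicities `m`: the products of their
differences avoid the finite set on which one of two solutions of the twisted Wronskian equation,
without common zeros in `z`, may still vanish at a point of `z`. -/
def IsGeneric {F : Type*} [Field F] (mu z : Fin 2 → F) (m : Fin 2 → ℕ) : Prop :=
  ∀ i a, (mu i - mu (i + 1)) * (z (a + 1) - z a) ∉ nongenericSet (m a) (m (a + 1))

lemma exists_twistedWronskian_add_one_eq {F : Type*} [Field F] {mu : Fin 2 → F} {p : Fin 2 → F[X]}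
    {c : F} {W : F[X]} (hc : c ≠ 0)
    (h : twistedWronskian (mu 0 - mu 1) (p 0) (p 1) = C c * W) (i : Fin 2) :
    ∃ c', c' ≠ 0 ∧ twistedWronskian (mu i - mu (i + 1)) (p i) (p (i + 1)) = C c' * W := by
  revert i
  refine Fin.forall_fin_two.2 ⟨⟨c, hc, h⟩, -c, neg_ne_zero.2 hc, ?_⟩
  rw [show (1 : Fin 2) + 1 = 0 from rfl, ← neg_sub, twistedWronskian_swap, h, C_neg, neg_mul]

variable {F : Type*} [Field F] [CharZero F] {mu z : Fin 2 → F} {m : Fin 2 → ℕ}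

lemma IsGeneric.eval_ne_zero (hg : IsGeneric mu z m) (hmu : Function.Injective mu)
    (hz : Function.Injective z) {c : F} (hc : c ≠ 0) {p : Fin 2 → F[X]}
    (h : twistedWronskian (mu 0 - mu 1) (p 0) (p 1) = C c * fusionPoly z m) {a : Fin 2}
    (hp : ∃ i, (p i).eval (z a) ≠ 0) (i : Fin 2) : (p i).eval (z a) ≠ 0 := by
  intro hpi
  have hy : (p (i + 1)).eval (z a) ≠ 0 := by
    obtain ⟨j, hj⟩ := hp
    obtain rfl : j = i + 1 := by
      have : j ≠ i := fun hji => hj (hji ▸ hpi)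
      omega
    exact hj
  obtain ⟨c', hc', hW⟩ := exists_twistedWronskian_add_one_eq hc h i
  rw [fusionPoly_eq_mul z m a] at hW
  refine hg i a (mul_sub_mem_nongenericSet (sub_ne_zero.2 (hmu.ne (add_one_ne_self_fin_two i).symm))
    (hz.ne (add_one_ne_self_fin_two a).symm) hc' hW
    (pow_succ_dvd_of_pow_dvd_twistedWronskian (κ := mu i - mu (i + 1)) ?_ hpi hy))
  rw [hW]
  exact (dvd_mul_right _ _).mul_left _

lemma exists_mvPolynomial_eval_ne_zero_imp {S : Set F} (hS : S.Finite) :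
    ∃ P : MvPolynomial (Fin 2 ⊕ Fin 2) F, P ≠ 0 ∧ ∀ mu z : Fin 2 → F,
      MvPolynomial.eval (Sum.elim mu z) P ≠ 0 →
        (mu 0 - mu 1) * (z 1 - z 0) ∉ S ∧ -((mu 0 - mu 1) * (z 1 - z 0)) ∉ S := by
  set D : MvPolynomial (Fin 2 ⊕ Fin 2) F :=
    (MvPolynomial.X (Sum.inl 0) - MvPolynomial.X (Sum.inl 1)) *
      (MvPolynomial.X (Sum.inr 1) - MvPolynomial.X (Sum.inr 0)) with hD
  have heval (mu z : Fin 2 → F) :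
      MvPolynomial.eval (Sum.elim mu z) D = (mu 0 - mu 1) * (z 1 - z 0) := by simp [hD]
  have hne (s : F) : D - MvPolynomial.C s ≠ 0 := fun h => by
    have := congrArg (MvPolynomial.eval (Sum.elim ![s + 1, 0] ![0, 1])) h
    simp [heval] at this
  refine ⟨∏ s ∈ hS.toFinset, (D - MvPolynomial.C s) * (D - MvPolynomial.C (-s)),
    Finset.prod_ne_zero_iff.2 fun s _ => mul_ne_zero (hne s) (hne (-s)), fun mu z h => ?_⟩
  simp only [map_prod, map_mul, map_sub, MvPolynomial.eval_C, heval, Finset.prod_ne_zero_iff,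
    mul_ne_zero_iff, sub_ne_zero, hS.mem_toFinset] at h
  exact ⟨fun hs => (h _ hs).1 rfl, fun hs => (h _ hs).2 (neg_neg _).symm⟩

lemma exists_mvPolynomial_isGeneric (n m : Fin 2 → ℕ) :
    ∃ P : MvPolynomial (Fin 2 ⊕ Fin 2) F, P ≠ 0 ∧ ∀ mu z : Fin 2 → F,
      MvPolynomial.eval (Sum.elim mu z) P ≠ 0 →
        Function.Injective mu ∧ Function.Injective z ∧ IsGeneric mu z m ∧ IsGeneric z mu n := by
  set S : Set F := {0} ∪ ⋃ a, nongenericSet (m a) (m (a + 1)) ∪ nongenericSet (n a) (n (a + 1))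
  have hS : S.Finite := (Set.finite_singleton 0).union (Set.finite_iUnion fun a =>
    (finite_nongenericSet _ _).union (finite_nongenericSet _ _))
  obtain ⟨P, hP, hgen⟩ := exists_mvPolynomial_eval_ne_zero_imp hS
  refine ⟨P, hP, fun mu z h => ?_⟩
  obtain ⟨hpos, hneg⟩ := hgen mu z h
  have h0 : (mu 0 - mu 1) * (z 1 - z 0) ≠ 0 := fun h0 => hpos (Or.inl h0)
  have hmem : ∀ i a, (mu i - mu (i + 1)) * (z (a + 1) - z a) ∉ S := by
    have h10 : (1 : Fin 2) + 1 = 0 := rfl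
    simp only [Fin.forall_fin_two, zero_add, h10]
    refine ⟨⟨hpos, ?_⟩, ?_, ?_⟩
    · rwa [← neg_sub (z 1), mul_neg]
    · rwa [← neg_sub (mu 0), neg_mul]
    · rwa [← neg_sub (mu 0), ← neg_sub (z 1), neg_mul_neg]
  refine ⟨injective_fin_two (sub_ne_zero.1 (left_ne_zero_of_mul h0)),
    injective_fin_two (sub_ne_zero.1 (right_ne_zero_of_mul h0)).symm,
    fun i a hs => hmem i a (Or.inr (Set.mem_iUnion.2 ⟨a, Or.inl hs⟩)),
    fun i a hs => hmem a i (Or.inr (Set.mem_iUnion.2 ⟨a, Or.inr ?_⟩))⟩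
  convert hs using 1
  ring

end FinTwo

section QuasiSum

variable {mu : Fin 2 → ℂ} {p : Fin 2 → ℂ[X]}

/-- The quasi-polynomial `∑ i, c i * p i * e^(μ i * x)`, as a linear function of the coefficients
`c`; its range is the space `⟨p₁ e^(μ₁x), p₂ e^(μ₂x)⟩`. -/
def quasiSum (mu : Fin 2 → ℂ) (p : Fin 2 → ℂ[X]) : (Fin 2 → ℂ) →ₗ[ℂ] ℂ → ℂ :=
  Fintype.linearCombination ℂ fun i x => (p i).eval x * Complex.exp (mu i * x)

lemma quasiSum_apply (mu : Fin 2 → ℂ) (p : Fin 2 → ℂ[X]) (c : Fin 2 → ℂ) (x : ℂ) :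
    quasiSum mu p c x = ∑ i, c i * ((p i).eval x * Complex.exp (mu i * x)) := by
  simp [quasiSum, Fintype.linearCombination_apply]

lemma quasiSum_single (mu : Fin 2 → ℂ) (p : Fin 2 → ℂ[X]) (i : Fin 2) :
    quasiSum mu p (Pi.single i 1) = fun x => (p i).eval x * Complex.exp (mu i * x) := by
  rw [quasiSum, Fintype.linearCombination_apply_single, one_smul]

lemma quasiSum_C_mul (mu : Fin 2 → ℂ) (p : Fin 2 → ℂ[X]) (c d : Fin 2 → ℂ) :
    quasiSum mu (fun i => C (c i) * p i) d = quasiSum mu p (c * d) := by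
  ext x
  simp only [quasiSum_apply, eval_mul, eval_C, Pi.mul_apply]
  exact Finset.sum_congr rfl fun i _ => by ring

lemma quasiSum_sub (mu : Fin 2 → ℂ) (p q : Fin 2 → ℂ[X]) (c : Fin 2 → ℂ) :
    quasiSum mu (p - q) c = quasiSum mu p c - quasiSum mu q c := by
  ext x
  simp only [quasiSum_apply, Pi.sub_apply, eval_sub, ← Finset.sum_sub_distrib]
  exact Finset.sum_congr rfl fun i _ => by ring

lemma range_quasiSum (mu : Fin 2 → ℂ) (p : Fin 2 → ℂ[X]) :
    LinearMap.range (quasiSum mu p) = quasiSpan mu p :=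
  Fintype.range_linearCombination ℂ _

lemma quasiSum_mem_quasiSpan (c : Fin 2 → ℂ) : quasiSum mu p c ∈ quasiSpan mu p :=
  range_quasiSum mu p ▸ LinearMap.mem_range_self _ c

lemma mem_quasiSpan_iff {f : ℂ → ℂ} : f ∈ quasiSpan mu p ↔ ∃ c, quasiSum mu p c = f := by
  rw [← range_quasiSum, LinearMap.mem_range]

lemma hasDerivAt_eval_mul_exp (p : ℂ[X]) (ν x : ℂ) :
    HasDerivAt (fun x => p.eval x * Complex.exp (ν * x))
      ((derivative p + C ν * p).eval x * Complex.exp (ν * x)) x := by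
  have hexp : HasDerivAt (fun x => Complex.exp (ν * x)) (Complex.exp (ν * x) * ν) x := by
    simpa using ((hasDerivAt_id x).const_mul ν).cexp
  refine ((p.hasDerivAt x).mul hexp).congr_deriv ?_
  simp only [eval_add, eval_mul, eval_C]; ring

lemma hasDerivAt_quasiSum (mu : Fin 2 → ℂ) (p : Fin 2 → ℂ[X]) (c : Fin 2 → ℂ) (x : ℂ) :
    HasDerivAt (quasiSum mu p c)
      (quasiSum mu (fun i => derivative (p i) + C (mu i) * p i) c x) x := by
  rw [quasiSum_apply, funext (quasiSum_apply mu p c)]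
  exact HasDerivAt.fun_sum fun i _ => (hasDerivAt_eval_mul_exp (p i) (mu i) x).const_mul (c i)

lemma differentiable_quasiSum (mu : Fin 2 → ℂ) (p : Fin 2 → ℂ[X]) (c : Fin 2 → ℂ) :
    Differentiable ℂ (quasiSum mu p c) :=
  fun x => (hasDerivAt_quasiSum mu p c x).differentiableAt

lemma wronskian_quasiSum (mu : Fin 2 → ℂ) (p : Fin 2 → ℂ[X]) (c d : Fin 2 → ℂ) :
    wronskian (quasiSum mu p c) (quasiSum mu p d) = fun x =>
      (c 1 * d 0 - c 0 * d 1) * ((twistedWronskian (mu 0 - mu 1) (p 0) (p 1)).eval x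
        * Complex.exp ((mu 0 + mu 1) * x)) := by
  ext x
  rw [wronskian, (hasDerivAt_quasiSum mu p c x).deriv, (hasDerivAt_quasiSum mu p d x).deriv,
    add_mul, Complex.exp_add]
  simp only [quasiSum_apply, twistedWronskian, eval_add, eval_sub, eval_mul, eval_C,
    Fin.sum_univ_two]
  ring

lemma eq_zero_of_quasiSum_one_eq_zero (hmu : mu 0 ≠ mu 1) (h : quasiSum mu p 1 = 0) : p = 0 := by
  have hW : twistedWronskian (mu 0 - mu 1) (p 0) (p 1) = 0 := by
    refine Polynomial.funext fun x => ?_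
    have hx := congrFun (wronskian_quasiSum mu p 1 (Pi.single 0 1)) x
    rw [h] at hx
    simpa [wronskian, Complex.exp_ne_zero] using hx.symm
  have hzero : p 0 = 0 ∨ p 1 = 0 := by
    by_contra! hp
    exact twistedWronskian_ne_zero (sub_ne_zero.2 hmu) hp.1 hp.2 hW
  have hsum : ∀ x, (p 0).eval x * Complex.exp (mu 0 * x) + (p 1).eval x * Complex.exp (mu 1 * x)
      = 0 := fun x => by
    simpa [quasiSum_apply, Fin.sum_univ_two] using congrFun h x
  rcases hzero with h0 | h1
  · have h1 : p 1 = 0 := Polynomial.funext fun x => by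
      simpa [h0, Complex.exp_ne_zero] using hsum x
    exact _root_.funext (Fin.forall_fin_two.2 ⟨h0, h1⟩)
  · have h0 : p 0 = 0 := Polynomial.funext fun x => by
      simpa [h1, Complex.exp_ne_zero] using hsum x
    exact _root_.funext (Fin.forall_fin_two.2 ⟨h0, h1⟩)

lemma injective_quasiSum (hmu : mu 0 ≠ mu 1) (hp : ∀ i, p i ≠ 0) :
    Function.Injective (quasiSum mu p) := by
  refine (injective_iff_map_eq_zero _).2 fun c hc => _root_.funext fun i => ?_
  rw [← mul_one c, ← quasiSum_C_mul] at hc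
  simpa [hp i] using congrFun (eq_zero_of_quasiSum_one_eq_zero hmu hc) i

lemma exists_eq_C_mul_of_quasiSpan_eq (hmu : mu 0 ≠ mu 1) {q : Fin 2 → ℂ[X]}
    (hq : ∀ i, q i ≠ 0) (h : quasiSpan mu p = quasiSpan mu q) (i : Fin 2) :
    ∃ c : ℂ, c ≠ 0 ∧ p i = C c * q i := by
  obtain ⟨c, hc⟩ := mem_quasiSpan_iff.1
    (h ▸ quasiSum_mem_quasiSpan (mu := mu) (p := q) (Pi.single i 1))
  have hcq : C (c i) * p i = q i := by
    have hdiff : quasiSum mu ((fun j => C (c j) * p j)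
        - fun j => C ((Pi.single i 1 : Fin 2 → ℂ) j) * q j) 1 = 0 := by
      rw [quasiSum_sub, quasiSum_C_mul, quasiSum_C_mul, mul_one, mul_one, hc, sub_self]
    simpa [sub_eq_zero] using congrFun (eq_zero_of_quasiSum_one_eq_zero hmu hdiff) i
  have hci : c i ≠ 0 := fun h0 => hq i (by rw [← hcq, h0, C_0, zero_mul])
  exact ⟨(c i)⁻¹, inv_ne_zero hci, by
    rw [← hcq, ← mul_assoc, ← C_mul, inv_mul_cancel₀ hci, C_1, one_mul]⟩

end QuasiSum

section Operator

variable {k : ℕ} {mu z : Fin 2 → ℂ} {m : Fin 2 → ℕ} {t : Fin k → ℂ}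

lemma firstOrderOp_quasiSum (nu : Fin 2 → ℂ) (p : Fin 2 → ℂ[X]) (c : Fin 2 → ℂ) (ν : ℂ)
    {y : ℂ[X]} {x : ℂ} (hy : y.eval x ≠ 0) :
    firstOrderOp (fun x => y.eval x * Complex.exp (ν * x)) (quasiSum nu p c) x
      = quasiSum nu (fun i => twistedWronskian (nu i - ν) (p i) y) c x / y.eval x := by
  have hlog : logDeriv (fun x => y.eval x * Complex.exp (ν * x)) x
      = (derivative y).eval x / y.eval x + ν := by
    have := Complex.exp_ne_zero (ν * x)
    rw [logDeriv_apply, (hasDerivAt_eval_mul_exp y ν x).deriv]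
    simp only [eval_add, eval_mul, eval_C]
    field_simp
  rw [firstOrderOp, hlog, (hasDerivAt_quasiSum nu p c x).deriv]
  simp only [quasiSum_apply, Finset.mul_sum, Finset.sum_div, ← Finset.sum_sub_distrib]
  refine Finset.sum_congr rfl fun i _ => ?_
  simp only [twistedWronskian, eval_add, eval_sub, eval_mul, eval_C]
  field_simp
  ring

lemma firstOrderOp_div_div {f g y : ℂ → ℂ} {x : ℂ} (hf : DifferentiableAt ℂ f x)
    (hg : DifferentiableAt ℂ g x) (hy : DifferentiableAt ℂ y x) (hg0 : g x ≠ 0) (hy0 : y x ≠ 0) :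
    firstOrderOp (fun s => g s / y s) (fun s => f s / y s) x = firstOrderOp g f x / y x := by
  rw [firstOrderOp, firstOrderOp, logDeriv_div x hg0 hy0 hg hy, deriv_fun_div hf hy hy0,
    logDeriv_apply y]
  field_simp
  ring

lemma firstOrderOp_congr {f₁ f₂ : ℂ → ℂ} {x : ℂ} (g : ℂ → ℂ) (h : f₁ =ᶠ[nhds x] f₂) :
    firstOrderOp g f₁ x = firstOrderOp g f₂ x := by
  rw [firstOrderOp, firstOrderOp, h.deriv_eq, h.eq_of_nhds]

lemma eval_nodal_ne_zero_iff {x : ℂ} :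
    (Lagrange.nodal Finset.univ t).eval x ≠ 0 ↔ ∀ j, x ≠ t j := by
  simp [Lagrange.eval_nodal, Finset.prod_ne_zero_iff, sub_ne_zero]

lemma criticalPointOp_quasiSum (nu : Fin 2 → ℂ) (p : Fin 2 → ℂ[X]) (c : Fin 2 → ℂ) {x : ℂ}
    (hT : (fusionPoly z m).eval x ≠ 0) (hy : (Lagrange.nodal Finset.univ t).eval x ≠ 0) :
    criticalPointOp mu z m t (quasiSum nu p c) x
      = quasiSum nu (fun i => twistedWronskian (nu i - mu 0) (twistedWronskian (nu i - mu 1) (p i)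
          (Lagrange.nodal Finset.univ t)) (fusionPoly z m)) c x
        / (fusionPoly z m).eval x / (Lagrange.nodal Finset.univ t).eval x := by
  have hinner : firstOrderOp (fun x => (∏ j, (x - t j)) * Complex.exp (mu 1 * x))
      (quasiSum nu p c) =ᶠ[nhds x] fun s => quasiSum nu (fun i => twistedWronskian (nu i - mu 1)
        (p i) (Lagrange.nodal Finset.univ t)) c s / (Lagrange.nodal Finset.univ t).eval s := by
    filter_upwards [(Lagrange.nodal Finset.univ t).continuous.continuousAt.eventually_ne hy]
      with s hs
    simpa only [Lagrange.eval_nodal] using firstOrderOp_quasiSum nu p c (mu 1) hs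
  have houter : (fun x => Complex.exp (mu 0 * x) * (∏ a, (x - z a) ^ m a) / ∏ j, (x - t j))
      = fun x => ((fusionPoly z m).eval x * Complex.exp (mu 0 * x))
        / (Lagrange.nodal Finset.univ t).eval x := by
    ext s; rw [Lagrange.eval_nodal, eval_fusionPoly, mul_comm (Complex.exp _)]
  rw [criticalPointOp, firstOrderOp_congr _ hinner, houter,
    firstOrderOp_div_div (differentiable_quasiSum _ _ _ x)
      (hasDerivAt_eval_mul_exp _ _ x).differentiableAt (Polynomial.differentiable _ x)
      (mul_ne_zero hT (Complex.exp_ne_zero _)) hy, firstOrderOp_quasiSum _ _ _ _ hT]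

lemma criticalPointOp_eq_zero_iff (nu : Fin 2 → ℂ) (p : Fin 2 → ℂ[X]) :
    (∀ f ∈ quasiSpan nu p, ∀ x, (∀ a, x ≠ z a) → (∀ j, x ≠ t j) →
      criticalPointOp mu z m t f x = 0) ↔
    ∀ i, twistedWronskian (nu i - mu 0) (twistedWronskian (nu i - mu 1) (p i)
      (Lagrange.nodal Finset.univ t)) (fusionPoly z m) = 0 := by
  have hT {x : ℂ} (hx : ∀ a, x ≠ z a) : (fusionPoly z m).eval x ≠ 0 :=
    eval_fusionPoly_ne_zero_iff.2 fun a _ => hx a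
  refine ⟨fun h i => ?_, fun h f hf x hxz hxt => ?_⟩
  · refine eq_zero_of_infinite_isRoot _ (Set.Infinite.mono (s := (Set.range z ∪ Set.range t)ᶜ)
      (fun x hx => ?_) ((Set.finite_range z).union (Set.finite_range t)).infinite_compl)
    simp only [Set.mem_compl_iff, Set.mem_union, Set.mem_range, not_or, not_exists] at hx
    have hxz : ∀ a, x ≠ z a := fun a => Ne.symm (hx.1 a)
    have hxt : ∀ j, x ≠ t j := fun j => Ne.symm (hx.2 j)
    have hop := h _ (quasiSum_mem_quasiSpan (Pi.single i 1)) x hxz hxt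
    rw [criticalPointOp_quasiSum nu p _ (hT hxz) (eval_nodal_ne_zero_iff.2 hxt),
      quasiSum_single] at hop
    simpa [hT hxz, eval_nodal_ne_zero_iff.2 hxt, Complex.exp_ne_zero] using hop
  · obtain ⟨c, rfl⟩ := mem_quasiSpan_iff.1 hf
    rw [criticalPointOp_quasiSum nu p c (hT hxz) (eval_nodal_ne_zero_iff.2 hxt)]
    simp [quasiSum_apply, h]

end Operator

section Exponents

lemma analyticOrderAt_eq_of_wronskian {f g w : ℂ → ℂ} {x : ℂ} {k : ℕ} (hf : AnalyticAt ℂ f x)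
    (hg : AnalyticAt ℂ g x) (hw : AnalyticAt ℂ w x) (hfx : f x = 0) (hgx : g x ≠ 0)
    (hwx : w x ≠ 0) (h : wronskian g f =ᶠ[nhds x] fun s => (s - x) ^ k * w s) :
    analyticOrderAt f x = (k + 1 : ℕ) := by
  have hquot : AnalyticAt ℂ (fun s => f s / g s) x := hf.fun_div hg hgx
  have hderiv : analyticOrderAt (deriv fun s => f s / g s) x = k := by
    rw [hquot.deriv.analyticOrderAt_eq_natCast]
    refine ⟨fun s => w s / g s ^ 2, hw.fun_div (hg.fun_pow 2) (pow_ne_zero 2 hgx),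
      div_ne_zero hwx (pow_ne_zero 2 hgx), ?_⟩
    filter_upwards [hf.eventually_analyticAt, hg.eventually_analyticAt,
      hg.continuousAt.eventually_ne hgx, h] with s hfs hgs hgs0 hs
    rw [deriv_fun_div hfs.differentiableAt hgs.differentiableAt hgs0, smul_eq_mul,
      ← mul_div_assoc, ← hs, wronskian]
    ring
  have hsucc := hquot.analyticOrderAt_deriv_add_one
  simp only [hderiv, hfx, zero_div, sub_zero] at hsucc
  have hprod : f =ᶠ[nhds x] (fun s => f s / g s) * g := by
    filter_upwards [hg.continuousAt.eventually_ne hgx] with s hs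
    simp [hs]
  rw [analyticOrderAt_congr hprod, analyticOrderAt_mul hquot hg, hg.analyticOrderAt_eq_zero.2 hgx,
    ← hsucc, add_zero, Nat.cast_succ]

variable {mu c : Fin 2 → ℂ} {p : Fin 2 → ℂ[X]} {b x : ℂ} {k : ℕ} {T : ℂ[X]}

lemma analyticOrderAt_quasiSum (hb : b ≠ 0)
    (h : twistedWronskian (mu 0 - mu 1) (p 0) (p 1) = C b * ((X - C x) ^ k * T))
    (hT : T.eval x ≠ 0) (hx : ∃ i, (p i).eval x ≠ 0) (hc : c ≠ 0)
    (hcx : quasiSum mu p c x = 0) : analyticOrderAt (quasiSum mu p c) x = (k + 1 : ℕ) := by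
  obtain ⟨i, hi⟩ := hx
  set d : Fin 2 → ℂ := Pi.single i 1 with hd
  have hdx : quasiSum mu p d x ≠ 0 := by
    rw [quasiSum_single]; exact mul_ne_zero hi (Complex.exp_ne_zero _)
  have hdet : d 1 * c 0 - d 0 * c 1 ≠ 0 := fun hdet => by
    have hc0 : c 0 * quasiSum mu p d x = 0 := by
      rw [quasiSum_apply, Fin.sum_univ_two] at hcx ⊢
      linear_combination d 0 * hcx + (p 1).eval x * Complex.exp (mu 1 * x) * hdet
    have hc1 : c 1 * quasiSum mu p d x = 0 := by
      rw [quasiSum_apply, Fin.sum_univ_two] at hcx ⊢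
      linear_combination d 1 * hcx - (p 0).eval x * Complex.exp (mu 0 * x) * hdet
    exact hc (_root_.funext (Fin.forall_fin_two.2 ⟨(mul_eq_zero.1 hc0).resolve_right hdx,
      (mul_eq_zero.1 hc1).resolve_right hdx⟩))
  refine analyticOrderAt_eq_of_wronskian ((differentiable_quasiSum mu p c).analyticAt x)
    ((differentiable_quasiSum mu p d).analyticAt x) (w := fun s => (d 1 * c 0 - d 0 * c 1) * b *
      (T.eval s * Complex.exp ((mu 0 + mu 1) * s))) (Differentiable.analyticAt (by fun_prop) x)
    hcx hdx (mul_ne_zero (mul_ne_zero hdet hb) (mul_ne_zero hT (Complex.exp_ne_zero _)))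
    (.of_forall fun s => ?_)
  simp only [wronskian_quasiSum, h, eval_mul, eval_C, eval_pow, eval_sub, eval_X]
  ring

lemma exponents_quasiSpan (hb : b ≠ 0)
    (h : twistedWronskian (mu 0 - mu 1) (p 0) (p 1) = C b * ((X - C x) ^ k * T))
    (hT : T.eval x ≠ 0) (hx : ∃ i, (p i).eval x ≠ 0) :
    exponents (quasiSpan mu p) x = {0, 1 + (k : ℤ)} := by
  have hord : ∀ c, meromorphicOrderAt (quasiSum mu p c) x
      = (analyticOrderAt (quasiSum mu p c) x).map (↑) := fun c =>
    ((differentiable_quasiSum mu p c).analyticAt x).meromorphicOrderAt_eq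
  have hord_zero {c : Fin 2 → ℂ} (hcx : quasiSum mu p c x ≠ 0) :
      meromorphicOrderAt (quasiSum mu p c) x = (0 : ℤ) := by
    rw [hord, ((differentiable_quasiSum mu p c).analyticAt x).analyticOrderAt_eq_zero.2 hcx]; rfl
  have hord_succ {c : Fin 2 → ℂ} (hc : c ≠ 0) (hcx : quasiSum mu p c x = 0) :
      meromorphicOrderAt (quasiSum mu p c) x = (1 + k : ℤ) := by
    rw [hord, analyticOrderAt_quasiSum hb h hT hx hc hcx, add_comm]; rfl
  ext o
  constructor
  · rintro ⟨f, hf, ho⟩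
    obtain ⟨c, rfl⟩ := mem_quasiSpan_iff.1 hf
    by_cases hcx : quasiSum mu p c x = 0
    · have hc : c ≠ 0 := by
        rintro rfl
        rw [map_zero, show meromorphicOrderAt (0 : ℂ → ℂ) x = ⊤ from
          meromorphicOrderAt_eq_top_iff.2 (.of_forall fun _ => rfl)] at ho
        exact WithTop.top_ne_coe ho
      exact Or.inr (WithTop.coe_injective (ho.symm.trans (hord_succ hc hcx)))
    · exact Or.inl (WithTop.coe_injective (ho.symm.trans (hord_zero hcx)))
  · obtain ⟨i, hi⟩ := hx
    rintro (rfl | rfl)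
    · refine ⟨_, quasiSum_mem_quasiSpan (Pi.single i 1), hord_zero ?_⟩
      rw [quasiSum_single]; exact mul_ne_zero hi (Complex.exp_ne_zero _)
    · refine ⟨_, quasiSum_mem_quasiSpan ![(p 1).eval x * Complex.exp (mu 1 * x),
        -((p 0).eval x * Complex.exp (mu 0 * x))], hord_succ (fun hzero => ?_) ?_⟩
      · have h1 := congrFun hzero 0
        have h0 := congrFun hzero 1
        fin_cases i <;> simp_all [Complex.exp_ne_zero]
      · simp only [quasiSum_apply, Fin.sum_univ_two, Matrix.cons_val_zero, Matrix.cons_val_one]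
        ring

end Exponents

section SpecialSpaces

variable {lam z : Fin 2 → ℂ} {m : Fin 2 → ℕ} {p : Fin 2 → ℂ[X]} {c : ℂ}

lemma exists_eval_ne_zero_of_eval_twistedWronskian_ne_zero {R : Type*} [CommRing R] {κ x : R}
    {p : Fin 2 → R[X]} (h : (twistedWronskian κ (p 0) (p 1)).eval x ≠ 0) :
    ∃ i, (p i).eval x ≠ 0 := by
  contrapose! h
  simp [twistedWronskian, h]

lemma isSpecialSpace_quasiSpan {n : Fin 2 → ℕ} (hlam : Function.Injective lam)
    (hz : Function.Injective z) (hdeg : ∀ i, (p i).degree = n i) (hc : c ≠ 0)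
    (hW : twistedWronskian (lam 0 - lam 1) (p 0) (p 1) = C c * fusionPoly z m)
    (hpz : ∀ a, ∃ i, (p i).eval (z a) ≠ 0) : IsSpecialSpace lam z n m (quasiSpan lam p) where
  mu_injective := hlam
  z_injective := hz
  exists_basis := ⟨p, hdeg, rfl⟩
  exponents_regular x hx := by
    have hT : (fusionPoly z m).eval x ≠ 0 := eval_fusionPoly_ne_zero_iff.2 fun a _ => hx a
    have hexp := exponents_quasiSpan (k := 0) hc (by rw [hW, pow_zero, one_mul]) hT
      (exists_eval_ne_zero_of_eval_twistedWronskian_ne_zero (κ := lam 0 - lam 1)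
        (by simpa [hW] using ⟨hc, hT⟩))
    simpa using hexp
  exponents_at a := by
    rw [fusionPoly_eq_mul z m a] at hW
    refine exponents_quasiSpan hc hW ?_ (hpz a)
    simpa [sub_eq_zero] using fun h => absurd (hz h) (add_one_ne_self_fin_two a).symm

variable {k : ℕ} {t : Fin k → ℂ}

lemma eval_nodal_ne_zero_of_isAdmissible (hA : IsAdmissible lam z m t) {a : Fin 2}
    (ha : m a ≠ 0) : (Lagrange.nodal Finset.univ t).eval (z a) ≠ 0 :=
  eval_nodal_ne_zero_iff.2 fun j => (hA.1 j a ha).symm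

lemma exists_eval_ne_zero_of_isAdmissible (hz : Function.Injective z) (hA : IsAdmissible lam z m t)
    {κ b : ℂ} (hc : c ≠ 0) (hW : twistedWronskian κ (p 0) (p 1) = C c * fusionPoly z m)
    (hb : b ≠ 0) (hp : p 1 = C b * Lagrange.nodal Finset.univ t) (a : Fin 2) :
    ∃ i, (p i).eval (z a) ≠ 0 := by
  by_cases ha : m a = 0
  · refine exists_eval_ne_zero_of_eval_twistedWronskian_ne_zero (κ := κ) ?_
    rw [hW, eval_mul, eval_C]
    exact mul_ne_zero hc (eval_fusionPoly_ne_zero_iff.2 fun b hb hab => hb (hz hab ▸ ha))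
  · refine ⟨1, ?_⟩
    rw [hp, eval_mul, eval_C]
    exact mul_ne_zero hb (eval_nodal_ne_zero_of_isAdmissible hA ha)

end SpecialSpaces

section AssociatedSpaces

lemma twistedWronskian_zero_eq_zero_iff {F : Type*} [Field F] [CharZero F] {p y : F[X]}
    (hy : y ≠ 0) : twistedWronskian 0 p y = 0 ↔ ∃ c, p = C c * y := by
  rw [twistedWronskian_eq_sub_wronskian, C_0, zero_mul, zero_sub, neg_eq_zero]
  refine ⟨exists_eq_C_mul_of_wronskian_eq_zero hy, ?_⟩
  rintro ⟨c, rfl⟩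
  simp only [Polynomial.wronskian, derivative_C_mul]; ring

variable {lam z : Fin 2 → ℂ} {n m : Fin 2 → ℕ}

lemma criticalPointOp_eq_zero_iff_exists {k : ℕ} {t : Fin k → ℂ} (hlam : lam 0 ≠ lam 1)
    (p : Fin 2 → ℂ[X]) :
    (∀ f ∈ quasiSpan lam p, ∀ x, (∀ a, x ≠ z a) → (∀ j, x ≠ t j) →
      criticalPointOp lam z m t f x = 0) ↔
    (∃ c, twistedWronskian (lam 0 - lam 1) (p 0) (Lagrange.nodal Finset.univ t)
      = C c * fusionPoly z m) ∧ ∃ b, p 1 = C b * Lagrange.nodal Finset.univ t := by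
  have hT : fusionPoly z m ≠ 0 := (monic_fusionPoly z m).ne_zero
  have hy : Lagrange.nodal Finset.univ t ≠ 0 := (Lagrange.nodal_monic).ne_zero
  rw [criticalPointOp_eq_zero_iff, Fin.forall_fin_two, sub_self, sub_self,
    twistedWronskian_zero_eq_zero_iff hT, ← twistedWronskian_zero_eq_zero_iff hy]
  refine and_congr_right' ⟨fun h => ?_, fun h => ?_⟩
  · by_contra h0
    exact twistedWronskian_ne_zero (sub_ne_zero.2 hlam.symm) h0 hT h
  · rw [h]; simp [twistedWronskian]

variable {t : Fin (n 1) → ℂ}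

theorem exists_isAssociatedSpace (hnm : n 0 + n 1 = m 0 + m 1) (hlam : Function.Injective lam)
    (hz : Function.Injective z) (hA : IsAdmissible lam z m t) (hC : IsCriticalPoint lam z m t) :
    ∃ V : Submodule ℂ (ℂ → ℂ), IsAssociatedSpace lam z n m t V := by
  have hlam01 : lam 0 ≠ lam 1 := hlam.ne zero_ne_one
  obtain ⟨p₀, hW⟩ :=
    (isCriticalPoint_iff_exists_twistedWronskian_eq hlam01 (hz.ne zero_ne_one) hA).1 hC
  set y := Lagrange.nodal Finset.univ t with hy
  have hy0 : y ≠ 0 := Lagrange.nodal_monic.ne_zero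
  have hyd : y.natDegree = n 1 := by simp [hy, Lagrange.natDegree_nodal]
  have hp₀ : p₀ ≠ 0 := by
    rintro rfl
    exact (monic_fusionPoly z m).ne_zero (by simp [← hW, twistedWronskian])
  have hp₀d : p₀.natDegree = n 0 := by
    have hdeg := natDegree_twistedWronskian (sub_ne_zero.2 hlam01) hp₀ hy0
    rw [hW, natDegree_fusionPoly, Fin.sum_univ_two] at hdeg
    omega
  have hW' : twistedWronskian (lam 0 - lam 1) p₀ y = C 1 * fusionPoly z m := by
    rw [hW, C_1, one_mul]
  refine ⟨quasiSpan lam ![p₀, y], isSpecialSpace_quasiSpan hlam hz ?_ one_ne_zero hW'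
    (exists_eval_ne_zero_of_isAdmissible hz hA one_ne_zero hW' one_ne_zero (by simp [hy])),
    (criticalPointOp_eq_zero_iff_exists hlam01 _).2 ⟨⟨1, hW'⟩, 1, by simp [hy]⟩⟩
  simp [Fin.forall_fin_two, degree_eq_natDegree, hp₀, hy0, hp₀d, hyd]

lemma exists_basis_of_isAssociatedSpace {V : Submodule ℂ (ℂ → ℂ)}
    (hV : IsAssociatedSpace lam z n m t V) :
    ∃ p : Fin 2 → ℂ[X], V = quasiSpan lam p ∧ (∀ i, p i ≠ 0) ∧ (∀ i, (p i).natDegree = n i) ∧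
      (∃ c, c ≠ 0 ∧ twistedWronskian (lam 0 - lam 1) (p 0) (p 1) = C c * fusionPoly z m) ∧
      ∃ b, b ≠ 0 ∧ p 1 = C b * Lagrange.nodal Finset.univ t := by
  obtain ⟨p, hdeg, rfl⟩ := hV.special.exists_basis
  have hlam01 : lam 0 ≠ lam 1 := hV.special.mu_injective.ne zero_ne_one
  have hp i : p i ≠ 0 := fun h => by simpa [h] using hdeg i
  obtain ⟨⟨c, hc⟩, b, hb⟩ := (criticalPointOp_eq_zero_iff_exists hlam01 p).1 hV.annihilates
  have hW : twistedWronskian (lam 0 - lam 1) (p 0) (p 1) = C (b * c) * fusionPoly z m := by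
    rw [hb, twistedWronskian_C_mul_right, hc, C_mul, mul_assoc]
  refine ⟨p, rfl, hp, fun i => natDegree_eq_of_degree_eq_some (hdeg i), ⟨b * c, ?_, hW⟩, b, ?_, hb⟩
  · intro h0
    exact twistedWronskian_ne_zero (sub_ne_zero.2 hlam01) (hp 0) (hp 1) (by simp [hW, h0])
  · rintro rfl
    exact hp 1 (by rw [hb, C_0, zero_mul])

lemma exists_eval_ne_zero_of_eq_C_mul_nodal (hnm : n 0 + n 1 = m 0 + m 1)
    (hA : IsAdmissible lam z m t) {p : ℂ[X]} {b : ℂ} (hb : b ≠ 0)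
    (hp : p = C b * Lagrange.nodal Finset.univ t) : ∃ a, p.eval (z a) ≠ 0 := by
  simp only [hp, eval_mul, eval_C, mul_ne_zero_iff, hb, ne_eq, not_false_eq_true, true_and]
  by_cases hm : ∃ a, m a ≠ 0
  · exact hm.imp fun a ha => eval_nodal_ne_zero_of_isAdmissible hA ha
  · push Not at hm
    have hn : n 1 = 0 := by have := hm 0; have := hm 1; omega
    exact ⟨0, eval_nodal_ne_zero_iff.2 fun j => absurd j.2 (by omega)⟩

end AssociatedSpaces

section Residue

open scoped Nat

/-- The polynomial in `u` whose product with `e^(ua)` is the residue of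
`e^(ux) h(x) / (x - a) ^ (k + 1)` at `x = a`. -/
def residuePoly (k : ℕ) (h : ℂ → ℂ) (a : ℂ) : ℂ[X] :=
  ∑ j ∈ Finset.range (k + 1), C (iteratedDeriv (k - j) h a / ((k - j)! * j !)) * X ^ j

variable {k : ℕ} {h : ℂ → ℂ} {a : ℂ}

lemma coeff_residuePoly (k : ℕ) (h : ℂ → ℂ) (a : ℂ) (j : ℕ) : (residuePoly k h a).coeff j =
    if j ≤ k then iteratedDeriv (k - j) h a / ((k - j)! * j !) else 0 := by
  simp [residuePoly, coeff_X_pow]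

lemma natDegree_residuePoly (hha : h a ≠ 0) : (residuePoly k h a).natDegree = k := by
  refine natDegree_eq_of_le_of_coeff_ne_zero (natDegree_le_iff_coeff_eq_zero.2 fun j hj => ?_) ?_
  · rw [coeff_residuePoly, if_neg hj.not_ge]
  · simp [coeff_residuePoly, hha, Nat.factorial_ne_zero]

lemma residuePoly_ne_zero (hha : h a ≠ 0) : residuePoly k h a ≠ 0 := fun hzero => by
  simpa [hzero, hha, Nat.factorial_ne_zero] using (coeff_residuePoly k h a k).symm

lemma factorial_mul_eval_residuePoly (hh : AnalyticAt ℂ h a) (u : ℂ) :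
    k ! * ((residuePoly k h a).eval u * Complex.exp (a * u))
      = iteratedDeriv k (fun x => Complex.exp (u * x) * h x) a := by
  rw [iteratedDeriv_fun_mul (Differentiable.analyticAt (by fun_prop) a).contDiffAt hh.contDiffAt,
    residuePoly, eval_finsetSum, Finset.sum_mul, Finset.mul_sum]
  refine Finset.sum_congr rfl fun j hj => ?_
  have hk := Nat.cast_ne_zero (R := ℂ).2 (k - j).factorial_ne_zero
  have hj' := Nat.cast_ne_zero (R := ℂ).2 j.factorial_ne_zero
  rw [iteratedDeriv_cexp_const_mul, Nat.cast_choose ℂ (Finset.mem_range_succ_iff.1 hj),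
    eval_mul, eval_C, eval_pow, eval_X, mul_comm a u]
  field_simp

lemma circleIntegral_exp_mul_div_pow {r : ℝ} (hr : 0 < r)
    (hh : DifferentiableOn ℂ h (Metric.closedBall a r)) (u : ℂ) :
    (∮ x in C(a, r), Complex.exp (u * x) * (h x / (x - a) ^ (k + 1)))
      = 2 * Real.pi * Complex.I * ((residuePoly k h a).eval u * Complex.exp (a * u)) := by
  have hexp : DifferentiableOn ℂ (fun x => Complex.exp (u * x) * h x) (Metric.closedBall a r) :=
    DifferentiableOn.fun_mul (by fun_prop) hh
  have hcauchy := hexp.circleIntegral_one_div_sub_center_pow_smul hr k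
  rw [← factorial_mul_eval_residuePoly
    (hh.analyticAt (Metric.closedBall_mem_nhds a hr))] at hcauchy
  have hk := Nat.cast_ne_zero (R := ℂ).2 k.factorial_ne_zero
  calc _ = ∮ x in C(a, r), (1 / (x - a) ^ (k + 1)) • (Complex.exp (u * x) * h x) := by
        congr 1; ext x; rw [smul_eq_mul]; ring
    _ = _ := by rw [hcauchy, smul_eq_mul]; field_simp

lemma residuePoly_eq_C_mul_of_le_analyticOrderAt {g : ℂ → ℂ} {c : ℂ} (hh : AnalyticAt ℂ h a)
    (hg : AnalyticAt ℂ g a) (hord : (k + 1 : ℕ) ≤ analyticOrderAt (h - c • g) a) :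
    residuePoly k h a = C c * residuePoly k g a := by
  have hcg : AnalyticAt ℂ (c • g) a := analyticAt_const.smul hg
  have hderiv (i : ℕ) (hi : i < k + 1) : iteratedDeriv i h a = c * iteratedDeriv i g a := by
    have hzero := (natCast_le_analyticOrderAt_iff_iteratedDeriv_eq_zero (hh.sub hcg)).1 hord i hi
    rwa [iteratedDeriv_sub hh.contDiffAt hcg.contDiffAt, iteratedDeriv_const_smul hg.contDiffAt,
      sub_eq_zero, smul_eq_mul] at hzero
  rw [residuePoly, residuePoly, Finset.mul_sum]
  refine Finset.sum_congr rfl fun j _ => ?_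
  rw [hderiv _ (by omega), mul_div_assoc, C_mul, mul_assoc]

lemma iteratedDeriv_id_mul (hh : AnalyticAt ℂ h a) (i : ℕ) :
    iteratedDeriv i (fun x => x * h x) a
      = a * iteratedDeriv i h a + i * iteratedDeriv (i - 1) h a := by
  rw [iteratedDeriv_fun_mul (f := fun x => x) contDiffAt_id hh.contDiffAt]
  rcases i with _ | i
  · simp
  · rw [Finset.sum_range_succ', Finset.sum_range_succ']
    simp [iteratedDeriv_fun_id, add_comm]

lemma residuePoly_id_mul (hh : AnalyticAt ℂ h a) :
    residuePoly k (fun x => x * h x) a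
      = derivative (residuePoly k h a) + C a * residuePoly k h a := by
  ext j
  rw [coeff_add, coeff_C_mul, coeff_derivative]
  simp only [coeff_residuePoly, iteratedDeriv_id_mul hh]
  rcases lt_trichotomy j k with hj | rfl | hj
  · obtain ⟨i, rfl⟩ := Nat.exists_eq_add_of_lt hj
    have hi := Nat.cast_ne_zero (R := ℂ).2 i.factorial_ne_zero
    have hj' := Nat.cast_ne_zero (R := ℂ).2 j.factorial_ne_zero
    have hi1 : (i : ℂ) + 1 ≠ 0 := Nat.cast_add_one_ne_zero i
    have hj1 : (j : ℂ) + 1 ≠ 0 := Nat.cast_add_one_ne_zero j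
    rw [if_pos hj.le, if_pos hj.le, if_pos (by omega), show j + i + 1 - j = i + 1 by omega,
      show j + i + 1 - (j + 1) = i by omega, Nat.add_sub_cancel, Nat.factorial_succ,
      Nat.factorial_succ]
    push_cast
    field_simp
    ring
  · simp [mul_div_assoc]
  · simp [hj.not_ge, show ¬ j + 1 ≤ k by omega]

end Residue

section DualPoly

lemma iteratedDeriv_eval (r : ℂ[X]) (k : ℕ) :
    iteratedDeriv k (fun x => r.eval x) = fun x => (derivative^[k] r).eval x := by
  induction k with
  | zero => rw [iteratedDeriv_zero, Function.iterate_zero_apply]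
  | succ k ih =>
    rw [iteratedDeriv_succ, ih, Function.iterate_succ_apply']
    exact _root_.funext fun x => Polynomial.deriv _

lemma iteratedDeriv_eval_of_natDegree_le {r : ℂ[X]} {k : ℕ} (hr : r.natDegree ≤ k) (x : ℂ) :
    iteratedDeriv k (fun x => r.eval x) x = k.factorial * r.coeff k := by
  have hconst : (derivative^[k] r).natDegree = 0 :=
    Nat.eq_zero_of_le_zero ((natDegree_iterate_derivative r k).trans (by omega))
  simp only [iteratedDeriv_eval]
  rw [eq_C_of_natDegree_eq_zero hconst, eval_C, coeff_iterate_derivative,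
    zero_add, Nat.descFactorial_self, nsmul_eq_mul]

lemma eval_residuePoly_eval_mul_exp {r : ℂ[X]} {k : ℕ} (hr : r.natDegree ≤ k) (a ν : ℂ) :
    (residuePoly k (fun x => r.eval x * Complex.exp (-ν * x)) a).eval ν * Complex.exp (a * ν)
      = r.coeff k := by
  have hk := Nat.cast_ne_zero (R := ℂ).2 k.factorial_ne_zero
  refine mul_left_cancel₀ hk ?_
  rw [factorial_mul_eval_residuePoly (Differentiable.analyticAt (by fun_prop) a),
    ← iteratedDeriv_eval_of_natDegree_le hr a]
  congr 1
  ext x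
  rw [mul_left_comm, ← Complex.exp_add, neg_mul, add_neg_cancel, Complex.exp_zero, mul_one]

lemma exists_eq_mul_pow_add_mul_pow {F : Type*} [Field F] {a b : F} (hab : a ≠ b) {k l : ℕ}
    {A : F[X]} (hA : A.natDegree ≤ k + l + 1) : ∃ r s : F[X], r.natDegree ≤ k ∧
      s.natDegree ≤ l ∧ A = r * (X - C b) ^ (l + 1) + s * (X - C a) ^ (k + 1) := by
  have hmonic : ((X - C a) ^ (k + 1)).Monic := (monic_X_sub_C a).pow _
  have hdeg (c : F) (i : ℕ) : ((X - C c) ^ i).natDegree = i := by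
    rw [natDegree_pow, natDegree_X_sub_C, mul_one]
  obtain ⟨u, v, huv⟩ : IsCoprime ((X - C a) ^ (k + 1)) ((X - C b) ^ (l + 1)) :=
    (isCoprime_X_sub_C_of_isUnit_sub (sub_ne_zero.2 hab).isUnit).pow
  set r := A * v %ₘ (X - C a) ^ (k + 1)
  set s := A * u + A * v /ₘ (X - C a) ^ (k + 1) * (X - C b) ^ (l + 1)
  have hrs : A = r * (X - C b) ^ (l + 1) + s * (X - C a) ^ (k + 1) := by
    linear_combination -A * huv
      - (X - C b) ^ (l + 1) * modByMonic_add_div (A * v) ((X - C a) ^ (k + 1))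
  have hr : r.natDegree ≤ k := Nat.lt_succ_iff.1 <| by
    simpa only [hdeg] using natDegree_modByMonic_lt (A * v) hmonic fun h => by
      simpa [hdeg] using congrArg natDegree h
  refine ⟨r, s, hr, ?_, hrs⟩
  by_contra! hs
  have hs0 : s ≠ 0 := fun h => by simp [h] at hs
  have hsdeg : (s * (X - C a) ^ (k + 1)).natDegree ≤ k + (l + 1) := by
    rw [← sub_eq_of_eq_add' hrs]
    exact (natDegree_sub_le_of_le hA (natDegree_mul_le_of_le hr (hdeg b _).le)).trans (by simp)
  rw [mul_comm, hmonic.natDegree_mul' hs0, hdeg] at hsdeg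
  omega

lemma coeff_mul_X_sub_C_pow {R : Type*} [CommRing R] [Nontrivial R] {r : R[X]} {k : ℕ}
    (hr : r.natDegree ≤ k) (b : R) (l : ℕ) : (r * (X - C b) ^ l).coeff (k + l) = r.coeff k := by
  have hdeg : ((X - C b) ^ l).natDegree = l := by
    rw [(monic_X_sub_C b).natDegree_pow, natDegree_X_sub_C, mul_one]
  have hlead := ((monic_X_sub_C b).pow l).coeff_natDegree
  rw [hdeg] at hlead
  rw [coeff_mul_add_eq_of_natDegree_le hr hdeg.le, hlead, mul_one]

lemma analyticAt_div_sub_pow {φ : ℂ → ℂ} {a b : ℂ} (hφ : Differentiable ℂ φ) (hab : a ≠ b)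
    (k : ℕ) : AnalyticAt ℂ (fun x => φ x / (x - b) ^ k) a :=
  (hφ.analyticAt a).fun_div (Differentiable.analyticAt (by fun_prop) a)
    (pow_ne_zero k (sub_ne_zero.2 hab))

lemma residuePoly_eval_mul_exp_div_pow {a b : ℂ} (hab : a ≠ b) {k l : ℕ} {A r s : ℂ[X]}
    (hA : A = r * (X - C b) ^ l + s * (X - C a) ^ (k + 1)) (ν : ℂ) :
    residuePoly k (fun x => A.eval x * Complex.exp (ν * x) / (x - b) ^ l) a
      = residuePoly k (fun x => r.eval x * Complex.exp (ν * x)) a := by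
  have hf : AnalyticAt ℂ (fun x => A.eval x * Complex.exp (ν * x) / (x - b) ^ l) a :=
    analyticAt_div_sub_pow (by fun_prop) hab l
  have hg : AnalyticAt ℂ (fun x => r.eval x * Complex.exp (ν * x)) a :=
    Differentiable.analyticAt (by fun_prop) a
  rw [residuePoly_eq_C_mul_of_le_analyticOrderAt (c := 1) hf hg, C_1, one_mul]
  rw [one_smul, natCast_le_analyticOrderAt (hf.sub hg)]
  refine ⟨fun x => s.eval x * Complex.exp (ν * x) / (x - b) ^ l,
    analyticAt_div_sub_pow (by fun_prop) hab l, ?_⟩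
  filter_upwards [isOpen_ne.mem_nhds hab] with x hx
  have hxb : x - b ≠ 0 := sub_ne_zero.2 hx
  simp only [Pi.sub_apply, hA, eval_add, eval_mul, eval_pow, eval_sub, eval_X, eval_C, smul_eq_mul]
  field_simp
  ring

variable {z : Fin 2 → ℂ} {m : Fin 2 → ℕ} {φ ψ : ℂ → ℂ}

/-- The residue of `e^(ux) φ(x) ∏ b, (x - z b) ^ (-m b - 1)` at `x = z a` is `e^(u z_a)` times a
polynomial in `u`: this polynomial. -/
def dualPoly (z : Fin 2 → ℂ) (m : Fin 2 → ℕ) (φ : ℂ → ℂ) (a : Fin 2) : ℂ[X] :=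
  residuePoly (m a) (fun x => φ x / (x - z (a + 1)) ^ (m (a + 1) + 1)) (z a)

lemma circleIntegral_exp_mul_div_prod (hφ : Differentiable ℂ φ) {a : Fin 2} {r : ℝ} (hr : 0 < r)
    (hra : ∀ b, b ≠ a → r < dist (z b) (z a)) (u : ℂ) :
    (∮ x in C(z a, r), Complex.exp (u * x) * (φ x / ∏ b, (x - z b) ^ (m b + 1)))
      = 2 * Real.pi * Complex.I
        * ((dualPoly z m φ a).eval u * Complex.exp (z a * u)) := by
  rw [dualPoly, ← circleIntegral_exp_mul_div_pow hr (DifferentiableOn.fun_div hφ.differentiableOn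
    (by fun_prop) fun x hx => pow_ne_zero _ (sub_ne_zero.2 ?_))]
  · simp only [prod_fin_two_eq_mul _ a, div_div, mul_comm]
  · rintro rfl
    exact (hra _ (add_one_ne_self_fin_two a)).not_ge (Metric.mem_closedBall.1 hx)

lemma dualPoly_ne_zero (hz : Function.Injective z) {a : Fin 2} (hφ : φ (z a) ≠ 0) :
    dualPoly z m φ a ≠ 0 :=
  residuePoly_ne_zero <| div_ne_zero hφ <|
    pow_ne_zero _ (sub_ne_zero.2 (hz.ne (add_one_ne_self_fin_two a).symm))

lemma natDegree_dualPoly (hz : Function.Injective z) {a : Fin 2} (hφ : φ (z a) ≠ 0) :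
    (dualPoly z m φ a).natDegree = m a :=
  natDegree_residuePoly <| div_ne_zero hφ <|
    pow_ne_zero _ (sub_ne_zero.2 (hz.ne (add_one_ne_self_fin_two a).symm))

lemma dualPoly_eq_C_mul_of_le_analyticOrderAt (hz : Function.Injective z)
    (hφ : Differentiable ℂ φ) (hψ : Differentiable ℂ ψ) {s : ℂ} {a : Fin 2}
    (h : (m a + 1 : ℕ) ≤ analyticOrderAt (φ - s • ψ) (z a)) :
    dualPoly z m φ a = C s * dualPoly z m ψ a := by
  have hne : z a ≠ z (a + 1) := hz.ne (add_one_ne_self_fin_two a).symm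
  refine residuePoly_eq_C_mul_of_le_analyticOrderAt (analyticAt_div_sub_pow hφ hne _)
    (analyticAt_div_sub_pow hψ hne _) ?_
  have hquot : AnalyticAt ℂ (fun x => 1 / (x - z (a + 1)) ^ (m (a + 1) + 1)) (z a) :=
    analyticAt_div_sub_pow (by fun_prop) hne _
  calc ((m a + 1 : ℕ) : ℕ∞) ≤ analyticOrderAt (φ - s • ψ) (z a) := h
    _ ≤ analyticOrderAt ((φ - s • ψ) * fun x => 1 / (x - z (a + 1)) ^ (m (a + 1) + 1)) (z a) := by
      rw [analyticOrderAt_mul ((hφ.sub (hψ.const_smul s)).analyticAt _) hquot]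
      exact le_self_add
    _ = _ := by
      congr 1; ext x
      simp only [Pi.mul_apply, Pi.sub_apply, Pi.smul_apply, smul_eq_mul]
      ring

lemma dualPoly_id_mul (hz : Function.Injective z) (hφ : Differentiable ℂ φ) (a : Fin 2) :
    dualPoly z m (fun x => x * φ x) a
      = derivative (dualPoly z m φ a) + C (z a) * dualPoly z m φ a := by
  simp only [dualPoly, mul_div_assoc]
  exact residuePoly_id_mul (analyticAt_div_sub_pow hφ (hz.ne (add_one_ne_self_fin_two a).symm) _)

lemma iteratedDeriv_quasiSum_dualPoly (hz : Function.Injective z) (hφ : Differentiable ℂ φ)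
    (c : Fin 2 → ℂ) (j : ℕ) : iteratedDeriv j (quasiSum z (dualPoly z m φ) c)
      = quasiSum z (dualPoly z m fun x => x ^ j * φ x) c := by
  induction j with
  | zero => simp only [iteratedDeriv_zero, pow_zero, one_mul]
  | succ j ih =>
    have hpow : Differentiable ℂ fun x => x ^ j * φ x := by fun_prop
    ext u
    rw [iteratedDeriv_succ, ih, (hasDerivAt_quasiSum z _ c u).deriv]
    simp only [← dualPoly_id_mul hz hpow, ← mul_assoc, ← pow_succ']

lemma quasiSum_dualPoly_eval_mul_exp_eq_zero (hz : Function.Injective z) {A : ℂ[X]}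
    (hA : A.natDegree ≤ m 0 + m 1) (ν : ℂ) :
    quasiSum z (dualPoly z m fun x => A.eval x * Complex.exp (-ν * x)) 1 ν = 0 := by
  obtain ⟨r, s, hr, hs, hrs⟩ := exists_eq_mul_pow_add_mul_pow (hz.ne zero_ne_one)
    (hA.trans (Nat.le_succ _))
  have hdual0 : dualPoly z m (fun x => A.eval x * Complex.exp (-ν * x)) 0 = _ :=
    residuePoly_eval_mul_exp_div_pow (hz.ne zero_ne_one) hrs (-ν)
  have hdual1 : dualPoly z m (fun x => A.eval x * Complex.exp (-ν * x)) 1 = _ :=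
    residuePoly_eval_mul_exp_div_pow (hz.ne one_ne_zero) (hrs.trans (add_comm _ _)) (-ν)
  have hcoeff : A.coeff (m 0 + m 1 + 1) = r.coeff (m 0) + s.coeff (m 1) := by
    rw [hrs, coeff_add, add_assoc, coeff_mul_X_sub_C_pow hr, add_left_comm, ← add_assoc,
      add_comm (m 0), add_assoc, add_comm 1, coeff_mul_X_sub_C_pow hs]
  rw [quasiSum_apply, Fin.sum_univ_two, hdual0, hdual1, eval_residuePoly_eval_mul_exp hr,
    eval_residuePoly_eval_mul_exp hs, Pi.one_apply, Pi.one_apply, one_mul, one_mul, ← hcoeff]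
  exact coeff_eq_zero_of_natDegree_lt (by omega)

lemma le_analyticOrderAt_quasiSum_dualPoly (hz : Function.Injective z) {A : ℂ[X]} {N : ℕ}
    (hA : A.natDegree + N ≤ m 0 + m 1 + 1) (ν : ℂ) :
    N ≤ analyticOrderAt
      (quasiSum z (dualPoly z m fun x => A.eval x * Complex.exp (-ν * x)) 1) ν := by
  refine (natCast_le_analyticOrderAt_iff_iteratedDeriv_eq_zero
    ((differentiable_quasiSum z _ 1).analyticAt ν)).2 fun j hj => ?_
  rw [iteratedDeriv_quasiSum_dualPoly hz (by fun_prop)]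
  have hdeg : (X ^ j * A).natDegree ≤ m 0 + m 1 := natDegree_mul_le.trans (by
    rw [natDegree_X_pow]; omega)
  simpa only [eval_mul, eval_pow, eval_X, mul_assoc] using
    quasiSum_dualPoly_eval_mul_exp_eq_zero hz hdeg ν

end DualPoly

section OrderDivisibility

lemma X_sub_C_pow_dvd_iff_le_analyticOrderAt {p : ℂ[X]} {s : ℂ} {k : ℕ} :
    (X - C s) ^ k ∣ p ↔ k ≤ analyticOrderAt (fun x => p.eval x) s := by
  rw [natCast_le_analyticOrderAt_iff_iteratedDeriv_eq_zero
    (Differentiable.analyticAt (by fun_prop) s)]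
  simp only [iteratedDeriv_eval]
  rcases eq_or_ne p 0 with rfl | hp
  · simp
  rcases k with _ | k
  · simp
  · rw [← le_rootMultiplicity_iff hp, Nat.succ_le_iff,
      lt_rootMultiplicity_iff_isRoot_iterate_derivative hp]
    simp only [Nat.lt_succ_iff, IsRoot.def]

lemma le_analyticOrderAt_deriv {f : ℂ → ℂ} {s : ℂ} {k : ℕ} (hf : AnalyticAt ℂ f s)
    (hord : k ≤ analyticOrderAt f s) : (k - 1 : ℕ) ≤ analyticOrderAt (deriv f) s := by
  rw [natCast_le_analyticOrderAt_iff_iteratedDeriv_eq_zero hf] at hord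
  refine (natCast_le_analyticOrderAt_iff_iteratedDeriv_eq_zero hf.deriv).2 fun i hi => ?_
  rw [← iteratedDeriv_succ']
  exact hord _ (by omega)

lemma le_analyticOrderAt_wronskian {f g : ℂ → ℂ} {s : ℂ} {k l : ℕ} (hf : AnalyticAt ℂ f s)
    (hg : AnalyticAt ℂ g s) (hford : k ≤ analyticOrderAt f s)
    (hgord : l ≤ analyticOrderAt g s) :
    (k + l - 1 : ℕ) ≤ analyticOrderAt (wronskian f g) s := by
  have hfg : ((k + l - 1 : ℕ) : ℕ∞) ≤ analyticOrderAt (f * deriv g) s := by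
    rw [analyticOrderAt_mul hf hg.deriv]
    refine (Nat.cast_le.2 ?_).trans ((Nat.cast_add k (l - 1)).le.trans
      (add_le_add hford (le_analyticOrderAt_deriv hg hgord)))
    omega
  have hgf : ((k + l - 1 : ℕ) : ℕ∞) ≤ analyticOrderAt (deriv f * g) s := by
    rw [analyticOrderAt_mul hf.deriv hg]
    refine (Nat.cast_le.2 ?_).trans ((Nat.cast_add (k - 1) l).le.trans
      (add_le_add (le_analyticOrderAt_deriv hf hford) hgord))
    omega
  exact (le_min hfg hgf).trans le_analyticOrderAt_sub

lemma X_sub_C_pow_dvd_twistedWronskian {mu : Fin 2 → ℂ} {p : Fin 2 → ℂ[X]} {c : Fin 2 → ℂ}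
    {s : ℂ} {k l : ℕ} (hc : c ≠ 0) (hord : (k + 1 : ℕ) ≤ analyticOrderAt (quasiSum mu p c) s)
    (hp : ∀ i, (X - C s) ^ l ∣ p i) :
    (X - C s) ^ (k + l) ∣ twistedWronskian (mu 0 - mu 1) (p 0) (p 1) := by
  obtain ⟨d, i, hd, hdet⟩ : ∃ (d : Fin 2 → ℂ) (i : Fin 2), d = Pi.single i 1 ∧
      c 1 * d 0 - c 0 * d 1 ≠ 0 := by
    obtain ⟨i, hi⟩ := Function.ne_iff.1 hc
    refine ⟨Pi.single (i + 1) 1, i + 1, rfl, ?_⟩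
    fin_cases i <;> simpa using hi
  have hdiff := differentiable_quasiSum mu p
  have hdord : l ≤ analyticOrderAt (quasiSum mu p d) s := by
    rw [hd, quasiSum_single, show (fun x => (p i).eval x * Complex.exp (mu i * x))
      = (fun x => (p i).eval x) * fun x => Complex.exp (mu i * x) from rfl,
      analyticOrderAt_mul (Differentiable.analyticAt (by fun_prop) s)
        (Differentiable.analyticAt (by fun_prop) s)]
    exact (X_sub_C_pow_dvd_iff_le_analyticOrderAt.1 (hp i)).trans le_self_add
  have hwr := le_analyticOrderAt_wronskian ((hdiff c).analyticAt s) ((hdiff d).analyticAt s)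
    hord hdord
  rw [X_sub_C_pow_dvd_iff_le_analyticOrderAt, show k + l = k + 1 + l - 1 by omega]
  have hexp : AnalyticAt ℂ (fun x => (c 1 * d 0 - c 0 * d 1) * Complex.exp ((mu 0 + mu 1) * x)) s :=
    Differentiable.analyticAt (by fun_prop) s
  refine hwr.trans_eq ?_
  rw [wronskian_quasiSum, ← add_zero (analyticOrderAt (fun x => eval x _) s),
    ← hexp.analyticOrderAt_eq_zero.2 (mul_ne_zero hdet (Complex.exp_ne_zero _)),
    ← analyticOrderAt_mul (Differentiable.analyticAt (by fun_prop) s) hexp]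
  congr 1; ext x
  rw [Pi.mul_apply]; ring

end OrderDivisibility

section Dual

variable {mu z : Fin 2 → ℂ} {m : Fin 2 → ℕ} {p : Fin 2 → ℂ[X]} {b : ℂ}

/-- The exponents of the space conjugate to `⟨p₁ e^(μ₁x), p₂ e^(μ₂x)⟩`: division by the Wronskian,
that is, by a polynomial times `e^((μ₁ + μ₂)x)`, turns `e^(μ₁x)` into `e^(-μ₂x)` and vice versa. -/
def conjugateExponents (mu : Fin 2 → ℂ) : Fin 2 → ℂ := fun i => -mu (i + 1)

lemma conjugateExponents_sub (mu : Fin 2 → ℂ) :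
    conjugateExponents mu 0 - conjugateExponents mu 1 = mu 0 - mu 1 := by
  simp only [conjugateExponents, zero_add, Fin.reduceAdd]; ring

lemma quasiSum_eq_exp_mul (mu : Fin 2 → ℂ) (p : Fin 2 → ℂ[X]) (c : Fin 2 → ℂ) (x : ℂ) :
    quasiSum mu p c x
      = Complex.exp ((mu 0 + mu 1) * x) * quasiSum (conjugateExponents mu) p c x := by
  have hexp (i : Fin 2) : Complex.exp (mu i * x)
      = Complex.exp ((mu 0 + mu 1) * x) * Complex.exp (conjugateExponents mu i * x) := by
    rw [← Complex.exp_add]; congr 1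
    fin_cases i <;> simp [conjugateExponents] <;> ring
  rw [quasiSum_apply, quasiSum_apply, Finset.mul_sum]
  exact Finset.sum_congr rfl fun i _ => by rw [hexp]; ring

lemma mem_conjugateSpace_quasiSpan_iff (hmu : mu 0 ≠ mu 1) (hp : ∀ i, p i ≠ 0) (hb : b ≠ 0)
    (h : twistedWronskian (mu 0 - mu 1) (p 0) (p 1) = C b * fusionPoly z m) {f : ℂ → ℂ} :
    f ∈ conjugateSpace (quasiSpan mu p) ↔ ∃ c : Fin 2 → ℂ,
      (fun x => quasiSum (conjugateExponents mu) p c x / (fusionPoly z m).eval x) = f := by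
  have hdiv (c d e : Fin 2 → ℂ) :
      (fun x => quasiSum mu p c x / wronskian (quasiSum mu p d) (quasiSum mu p e) x)
        = fun x => quasiSum (conjugateExponents mu) p (((d 1 * e 0 - d 0 * e 1) * b)⁻¹ • c) x
          / (fusionPoly z m).eval x := by
    ext x
    have hexp := Complex.exp_ne_zero ((mu 0 + mu 1) * x)
    simp only [quasiSum_eq_exp_mul mu p c, wronskian_quasiSum, h, map_smul, Pi.smul_apply,
      smul_eq_mul, eval_mul, eval_C]
    field_simp
  constructor
  · suffices hle : conjugateSpace (quasiSpan mu p) ≤ LinearMap.range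
        (LinearMap.mulLeft ℂ (fun x => ((fusionPoly z m).eval x)⁻¹)
          ∘ₗ quasiSum (conjugateExponents mu) p) by
      intro hf
      obtain ⟨c, rfl⟩ := hle hf
      exact ⟨c, _root_.funext fun x => div_eq_inv_mul _ _⟩
    refine Submodule.span_le.2 ?_
    rintro _ ⟨f, hf, d, hd, e, he, -, rfl⟩
    obtain ⟨c, rfl⟩ := mem_quasiSpan_iff.1 hf
    obtain ⟨d, rfl⟩ := mem_quasiSpan_iff.1 hd
    obtain ⟨e, rfl⟩ := mem_quasiSpan_iff.1 he
    exact ⟨_, (_root_.funext fun x => (div_eq_inv_mul _ _).symm).trans (hdiv c d e).symm⟩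
  · rintro ⟨c, rfl⟩
    refine Submodule.subset_span ⟨_, quasiSum_mem_quasiSpan (b • c), _,
      quasiSum_mem_quasiSpan (Pi.single 1 1), _, quasiSum_mem_quasiSpan (Pi.single 0 1), ?_, ?_⟩
    · refine LinearIndependent.pair_iff.2 fun s t hst => ?_
      rw [← map_smul, ← map_smul, ← map_add] at hst
      have hst0 := injective_quasiSum hmu hp (hst.trans (map_zero _).symm)
      exact ⟨by simpa using congrFun hst0 1, by simpa using congrFun hst0 0⟩
    · rw [hdiv]
      simp [smul_smul, hb]

lemma dualPoly_quasiSum (hz : Function.Injective z) (hb : b ≠ 0)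
    (h : twistedWronskian (mu 0 - mu 1) (p 0) (p 1) = C b * fusionPoly z m) {d : Fin 2 → ℂ}
    {a : Fin 2} (hd : quasiSum mu p d (z a) ≠ 0) (c : Fin 2 → ℂ) :
    dualPoly z m (quasiSum mu p c) a
      = C (quasiSum mu p c (z a) / quasiSum mu p d (z a)) * dualPoly z m (quasiSum mu p d) a := by
  set s := quasiSum mu p c (z a) / quasiSum mu p d (z a) with hs
  refine dualPoly_eq_C_mul_of_le_analyticOrderAt hz (differentiable_quasiSum mu p c)
    (differentiable_quasiSum mu p d) ?_
  rw [← map_smul, ← map_sub]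
  rcases eq_or_ne (c - s • d) 0 with hcd | hcd
  · rw [hcd, map_zero]
    exact le_top.trans (analyticOrderAt_eq_top.2 (.of_forall fun _ => rfl)).ge
  · rw [fusionPoly_eq_mul z m a] at h
    refine (analyticOrderAt_quasiSum hb h ?_ ?_ hcd ?_).ge
    · rw [eval_pow, eval_sub, eval_X, eval_C]
      exact pow_ne_zero _ (sub_ne_zero.2 (hz.ne (add_one_ne_self_fin_two a).symm))
    · by_contra! hpa
      exact hd (by simp [quasiSum_apply, hpa])
    · rw [map_sub, map_smul, Pi.sub_apply, Pi.smul_apply, smul_eq_mul, hs,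
        div_mul_cancel₀ _ hd, sub_self]

lemma exists_pos_forall_lt_dist (hz : Function.Injective z) (a : Fin 2) :
    ∃ r > 0, ∀ b, b ≠ a → r < dist (z b) (z a) := by
  have hpos : 0 < dist (z (a + 1)) (z a) := dist_pos.2 (hz.ne (add_one_ne_self_fin_two a))
  refine ⟨dist (z (a + 1)) (z a) / 2, half_pos hpos, fun b hb => ?_⟩
  obtain rfl : b = a + 1 := by omega
  exact half_lt_self hpos

lemma specialBispectralDual_quasiSpan (hmu : mu 0 ≠ mu 1) (hz : Function.Injective z)
    (hp : ∀ i, p i ≠ 0) (hb : b ≠ 0)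
    (h : twistedWronskian (mu 0 - mu 1) (p 0) (p 1) = C b * fusionPoly z m) {d : Fin 2 → ℂ}
    (hd : ∀ a, quasiSum (conjugateExponents mu) p d (z a) ≠ 0) :
    specialBispectralDual z (quasiSpan mu p)
      = quasiSpan z (dualPoly z m (quasiSum (conjugateExponents mu) p d)) := by
  set φ := quasiSum (conjugateExponents mu) p
  have hcontour (c : Fin 2 → ℂ) {a : Fin 2} {r : ℝ} (hr : 0 < r)
      (hra : ∀ b, b ≠ a → r < dist (z b) (z a)) :
      (fun u => ∮ x in C(z a, r), Complex.exp (u * x) * (φ c x / (fusionPoly z m).eval x)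
        * ∏ b, (x - z b)⁻¹)
      = (2 * Real.pi * Complex.I * (φ c (z a) / φ d (z a))) • fun u : ℂ =>
        (dualPoly z m (φ d) a).eval u * Complex.exp (z a * u) := by
    ext u
    have hφ : dualPoly z m (φ c) a = _ :=
      dualPoly_quasiSum hz hb ((conjugateExponents_sub mu).symm ▸ h) (hd a) c
    have hint := circleIntegral_exp_mul_div_prod (m := m)
      (differentiable_quasiSum (conjugateExponents mu) p c) hr hra u
    rw [hφ, eval_mul, eval_C] at hint
    rw [Pi.smul_apply, smul_eq_mul, mul_assoc, ← mul_assoc (φ c (z a) / φ d (z a)), ← hint]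
    refine congrArg (fun f => circleIntegral f (z a) r) (_root_.funext fun x => ?_)
    simp only [eval_fusionPoly, pow_succ, Finset.prod_mul_distrib, Finset.prod_inv_distrib]
    ring
  refine le_antisymm (Submodule.span_le.2 ?_) (Submodule.span_le.2 ?_)
  · rintro _ ⟨f, hf, a, r, hr, hra, rfl⟩
    obtain ⟨c, rfl⟩ := (mem_conjugateSpace_quasiSpan_iff hmu hp hb h).1 hf
    exact hcontour c hr hra ▸ Submodule.smul_mem _ _ (Submodule.subset_span ⟨a, rfl⟩)
  · rintro _ ⟨a, rfl⟩
    obtain ⟨r, hr, hra⟩ := exists_pos_forall_lt_dist hz a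
    have hscalar : 2 * Real.pi * Complex.I * (φ d (z a) / φ d (z a)) ≠ 0 :=
      mul_ne_zero Complex.two_pi_I_ne_zero (div_ne_zero (hd a) (hd a))
    rw [SetLike.mem_coe, ← Submodule.smul_mem_iff _ hscalar, ← hcontour d hr hra]
    exact Submodule.subset_span
      ⟨_, (mem_conjugateSpace_quasiSpan_iff hmu hp hb h).2 ⟨d, rfl⟩, a, r, hr, hra, rfl⟩

end Dual

section Duality

variable {mu z : Fin 2 → ℂ} {n m : Fin 2 → ℕ} {p g : Fin 2 → ℂ[X]} {b : ℂ}

lemma exists_twistedWronskian_eq_of_le_analyticOrderAt (hz : z 0 ≠ z 1)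
    (hmu : Function.Injective mu) (hg : ∀ a, g a ≠ 0)
    (hdeg : (g 0).natDegree + (g 1).natDegree = n 0 + n 1) {τ : Fin 2 → Fin 2 → ℂ}
    (hτ : ∀ i, τ i ≠ 0)
    (hord : ∀ i, (n i + 1 : ℕ) ≤ analyticOrderAt (quasiSum z g (τ i)) (mu i)) :
    ∃ c, c ≠ 0 ∧ twistedWronskian (z 0 - z 1) (g 0) (g 1) = C c * fusionPoly mu n := by
  have hκ := sub_ne_zero.2 hz
  refine ⟨_, leadingCoeff_ne_zero.2 (twistedWronskian_ne_zero hκ (hg 0) (hg 1)),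
    eq_leadingCoeff_mul_of_monic_of_dvd_of_natDegree_le (monic_fusionPoly mu n)
      (fusionPoly_dvd hmu fun i => ?_) ?_⟩
  · simpa using X_sub_C_pow_dvd_twistedWronskian (l := 0) (hτ i) (hord i) (by simp)
  · rw [natDegree_twistedWronskian hκ (hg 0) (hg 1), natDegree_fusionPoly, Fin.sum_univ_two, hdeg]

lemma exists_eval_ne_zero_of_le_analyticOrderAt (hmu : Function.Injective mu) (hb : b ≠ 0)
    (h : twistedWronskian (z 0 - z 1) (g 0) (g 1) = C b * fusionPoly mu n) {τ : Fin 2 → ℂ}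
    {i : Fin 2} (hτ : τ ≠ 0) (hord : (n i + 1 : ℕ) ≤ analyticOrderAt (quasiSum z g τ) (mu i)) :
    ∃ a, (g a).eval (mu i) ≠ 0 := by
  by_contra! hroot
  have hdvd : (X - C (mu i)) ^ (n i + 1) ∣ C b * fusionPoly mu n :=
    h ▸ X_sub_C_pow_dvd_twistedWronskian hτ hord fun a => by
      simpa using dvd_iff_isRoot.2 (hroot a)
  rw [(isUnit_C.2 hb.isUnit).dvd_mul_left, fusionPoly_eq_mul mu n i, pow_succ,
    mul_dvd_mul_iff_left (pow_ne_zero _ (X_sub_C_ne_zero _)), dvd_iff_isRoot] at hdvd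
  have hne : mu i - mu (i + 1) ≠ 0 := sub_ne_zero.2 (hmu.ne (add_one_ne_self_fin_two i).symm)
  exact pow_ne_zero _ hne (by simpa using hdvd)

lemma exists_le_analyticOrderAt_quasiSum_dualPoly (hz : Function.Injective z) (hb : b ≠ 0)
    (h : twistedWronskian (mu 0 - mu 1) (p 0) (p 1) = C b * fusionPoly z m)
    (hpd : ∀ i, (p i).natDegree = n i) (hnm : n 0 + n 1 = m 0 + m 1) {d : Fin 2 → ℂ}
    (hd : ∀ a, quasiSum (conjugateExponents mu) p d (z a) ≠ 0) {i : Fin 2}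
    (hp : ∃ a, (p (i + 1)).eval (z a) ≠ 0) :
    ∃ τ : Fin 2 → ℂ, τ ≠ 0 ∧ (n i + 1 : ℕ) ≤ analyticOrderAt
      (quasiSum z (dualPoly z m (quasiSum (conjugateExponents mu) p d)) τ) (mu i) := by
  have hi : i + 1 + 1 = i := by omega
  set φ := quasiSum (conjugateExponents mu) p with hφ
  have hφi : φ (Pi.single (i + 1) 1)
      = fun x => (p (i + 1)).eval x * Complex.exp (-mu i * x) := by
    rw [hφ, quasiSum_single, conjugateExponents, hi]
  refine ⟨fun a => φ (Pi.single (i + 1) 1) (z a) / φ d (z a), fun hzero => ?_, ?_⟩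
  · obtain ⟨a, ha⟩ := hp
    refine div_ne_zero ?_ (hd a) (congrFun hzero a)
    simpa [hφi] using ha
  · have hdual : dualPoly z m (φ (Pi.single (i + 1) 1)) = fun a =>
        C (φ (Pi.single (i + 1) 1) (z a) / φ d (z a)) * dualPoly z m (φ d) a :=
      _root_.funext fun a =>
        dualPoly_quasiSum hz hb ((conjugateExponents_sub mu).symm ▸ h) (hd a) _
    have hdeg : (p (i + 1)).natDegree + (n i + 1) ≤ m 0 + m 1 + 1 := by
      rw [hpd, ← hnm]; fin_cases i <;> simp <;> omega
    have hle := le_analyticOrderAt_quasiSum_dualPoly (m := m) hz hdeg (mu i)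
    rwa [← hφi, hdual, quasiSum_C_mul, mul_one] at hle

theorem exists_specialBispectralDual_quasiSpan_eq (hmu : Function.Injective mu)
    (hz : Function.Injective z) (hb : b ≠ 0)
    (h : twistedWronskian (mu 0 - mu 1) (p 0) (p 1) = C b * fusionPoly z m)
    (hpd : ∀ i, (p i).natDegree = n i) (hnm : n 0 + n 1 = m 0 + m 1)
    (h0 : ∀ a, (p 0).eval (z a) ≠ 0) (h1 : ∃ a, (p 1).eval (z a) ≠ 0) :
    ∃ g : Fin 2 → ℂ[X], specialBispectralDual z (quasiSpan mu p) = quasiSpan z g ∧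
      (∀ a, g a ≠ 0) ∧ (∀ a, (g a).natDegree = m a) ∧
      (∃ c, c ≠ 0 ∧ twistedWronskian (z 0 - z 1) (g 0) (g 1) = C c * fusionPoly mu n) ∧
      ∀ i, ∃ a, (g a).eval (mu i) ≠ 0 := by
  have hp : ∀ i, ∃ a, (p i).eval (z a) ≠ 0 := Fin.forall_fin_two.2 ⟨⟨0, h0 0⟩, h1⟩
  have hp0 (i : Fin 2) : p i ≠ 0 := by
    obtain ⟨a, ha⟩ := hp i
    exact fun hzero => ha (by rw [hzero, eval_zero])
  have hd : ∀ a, quasiSum (conjugateExponents mu) p (Pi.single 0 1) (z a) ≠ 0 := fun a => by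
    simpa [quasiSum_single] using h0 a
  set g := dualPoly z m (quasiSum (conjugateExponents mu) p (Pi.single 0 1))
  have hg (a : Fin 2) : g a ≠ 0 := dualPoly_ne_zero hz (hd a)
  have hgd (a : Fin 2) : (g a).natDegree = m a := natDegree_dualPoly hz (hd a)
  choose τ hτ hord using fun i =>
    exists_le_analyticOrderAt_quasiSum_dualPoly hz hb h hpd hnm hd (hp (i + 1))
  obtain ⟨c, hc, hW⟩ := exists_twistedWronskian_eq_of_le_analyticOrderAt
    (hz.ne zero_ne_one) hmu hg (by rw [hgd, hgd, hnm]) hτ hord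
  exact ⟨g, specialBispectralDual_quasiSpan (hmu.ne zero_ne_one) hz hp0 hb h hd, hg, hgd,
    ⟨c, hc, hW⟩, fun i => exists_eval_ne_zero_of_le_analyticOrderAt hmu hc hW (hτ i) (hord i)⟩

lemma representsAdmissibleCriticalPoint_of_quasiSpan_eq (hmu : Function.Injective mu)
    (hz : Function.Injective z) (hb : b ≠ 0)
    (h : twistedWronskian (mu 0 - mu 1) (p 0) (p 1) = C b * fusionPoly z m) (hp : ∀ i, p i ≠ 0)
    {i : Fin 2} (hpz : ∀ a, (p i).eval (z a) ≠ 0) {q : Fin 2 → ℂ[X]}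
    (hq : quasiSpan mu q = quasiSpan mu p) :
    RepresentsAdmissibleCriticalPoint (p i).natDegree ![mu (i + 1), mu i] z m (q i) := by
  obtain ⟨s, hs, hqs⟩ := exists_eq_C_mul_of_quasiSpan_eq (hmu.ne zero_ne_one) hp hq i
  obtain ⟨c, hc, hW⟩ := exists_twistedWronskian_add_one_eq hb h (i + 1)
  rw [show i + 1 + 1 = i by omega] at hW
  refine representsAdmissibleCriticalPoint_of_twistedWronskian_eq (p := p (i + 1)) (c := s * c)
    (hmu.ne (add_one_ne_self_fin_two i)) (hz.ne zero_ne_one) (mul_ne_zero hs hc) ?_ (fun a => ?_) ?_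
  · change twistedWronskian (mu (i + 1) - mu i) _ _ = _
    rw [hqs, twistedWronskian_C_mul_right, hW, C_mul, mul_assoc]
  · rw [hqs, eval_mul, eval_C]
    exact mul_ne_zero hs (hpz a)
  · rw [hqs, natDegree_C_mul hs]

end Duality

end GaudinDuality

end

theorem mainTheorem6 (n m : Fin 2 → ℕ) (hnm : n 0 + n 1 = m 0 + m 1) :
    -- generic parameters: off the zero set of a nonzero polynomial depending only on n and m
    ∃ P : MvPolynomial (Fin 2 ⊕ Fin 2) ℂ, P ≠ 0 ∧
      ∀ lam z : Fin 2 → ℂ, MvPolynomial.eval (Sum.elim lam z) P ≠ 0 →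
      ∀ t : Fin (n 1) → ℂ,
        GaudinDuality.IsAdmissible lam z m t → GaudinDuality.IsCriticalPoint lam z m t →
        (∃ V : Submodule ℂ (ℂ → ℂ), GaudinDuality.IsAssociatedSpace lam z n m t V) ∧
        ∀ V : Submodule ℂ (ℂ → ℂ), GaudinDuality.IsAssociatedSpace lam z n m t V →
          (∃ q : Fin 2 → Polynomial ℂ,
            GaudinDuality.specialBispectralDual z V = GaudinDuality.quasiSpan z q) ∧
          ∀ p q : Fin 2 → Polynomial ℂ,
            V = GaudinDuality.quasiSpan lam p →
            GaudinDuality.specialBispectralDual z V = GaudinDuality.quasiSpan z q →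
            GaudinDuality.RepresentsAdmissibleCriticalPoint (n 0) ![lam 1, lam 0] z m (p 0) ∧
            GaudinDuality.RepresentsAdmissibleCriticalPoint (m 1) z lam n (q 1) := by
  open GaudinDuality in
  obtain ⟨P, hP, hgeneric⟩ := exists_mvPolynomial_isGeneric (F := ℂ) n m
  refine ⟨P, hP, fun lam z hlz t hA hC => ?_⟩
  obtain ⟨hlam, hz, hgen, hgen'⟩ := hgeneric lam z hlz
  refine ⟨exists_isAssociatedSpace hnm hlam hz hA hC, fun V hV => ?_⟩
  obtain ⟨p, rfl, hp, hpdeg, ⟨b, hb, hWp⟩, s, hs, hpt⟩ := exists_basis_of_isAssociatedSpace hV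
  have hp0 (a : Fin 2) : (p 0).eval (z a) ≠ 0 := hgen.eval_ne_zero hlam hz hb hWp
    (exists_eval_ne_zero_of_isAdmissible hz hA hb hWp hs hpt a) 0
  obtain ⟨g, hdual, hg, hgdeg, ⟨c, hc, hWg⟩, hglam⟩ :=
    exists_specialBispectralDual_quasiSpan_eq hlam hz hb hWp hpdeg hnm hp0
      (exists_eval_ne_zero_of_eq_C_mul_nodal hnm hA hs hpt)
  have hg1 (i : Fin 2) : (g 1).eval (lam i) ≠ 0 := hgen'.eval_ne_zero hz hlam hc hWg (hglam i) 1
  refine ⟨⟨g, hdual⟩, fun p' q' hp' hq' => ⟨?_, ?_⟩⟩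
  · exact hpdeg 0 ▸
      representsAdmissibleCriticalPoint_of_quasiSpan_eq hlam hz hb hWp hp hp0 hp'.symm
  · have hz01 : ![z (1 + 1), z 1] = z := by ext i; fin_cases i <;> rfl
    exact hgdeg 1 ▸ hz01 ▸ representsAdmissibleCriticalPoint_of_quasiSpan_eq hz hlam hc hWg hg hg1
      (hq'.symm.trans hdual)
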